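/- Let $d\ge 1$ and let $C_d^{\rm TF}=4\pi\,\frac{d}{d+2}\,\Gamma(1+d/2)^{2/d}$. Let $\gamma$ be a trace-class operator on $L^2(\mathbb{R}^d)$ (complex-valued functions) with $0\le\gamma\le 1$, and let $\rho$ be its density, i.e. the diagonal of its integral kernel: the a.e. unique function $\rho\ge 0$ with $\int_A\rho=\operatorname{Tr}(\mathbf 1_A\gamma\mathbf 1_A)$ for all measurable $A\subset\mathbb{R}^d$. Let $\operatorname{Tr}(-\Delta)\gamma\in[0,\infty]$ denote the trace of the positive operator $-\nabla\gamma\nabla$, i.e. of the quadratic form $f\mapsto\sum_{j=1}^d\langle\partial_jf,\gamma\,\partial_jf\rangle$. (i) For every measurable function $\eta:\mathbb{R}_+\to\mathbb{R}$ with $$\int_0^\infty\eta(t)^2\,\frac{dt}{t}=1=\int_0^\infty\eta(t)^2\,t\,dt$$ one has $$\operatorname{Tr}(-\Delta)\gamma\;\ge\;\frac{C_d^{\rm TF}}{\left(\int_0^\infty\eta(t)^2t^{d+1}\,dt\right)^{2/d}}\int_{\mathbb{R}^d}\rho^{1+2/d}\;-\;\frac{4}{d^2}\int_{\mathbb{R}^d}|\nabla\sqrt\rho|^2\int_0^\infty\eta'(t)^2\,t\,dt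 .$$ (ii) For every $\epsilon>0$ the function $\eta(t)=(\pi\epsilon)^{-1/4}\exp\left(-(\epsilon/2+\ln t)^2/(2\epsilon)\right)$ satisfies the two normalization conditions in (i), $\int_0^\infty\eta(t)^2t^{d+1}\,dt=e^{\epsilon d(2+d)/4}$ and $\int_0^\infty\eta'(t)^2\,t\,dt=\frac1{2\epsilon}$, and $$\operatorname{Tr}(-\Delta)\gamma\;\ge\;C_d^{\rm TF}\,e^{-\epsilon(1+d/2)}\int_{\mathbb{R}^d}\rho^{1+2/d}\;-\;\frac{2}{d^2\epsilon}\int_{\mathbb{R}^d}|\nabla\sqrt\rho|^2 .$$ Here derivatives are weak derivatives, all integrals take values in $[0,\infty]$, and $\int|\nabla\sqrt\rho|^2$, respectively $\int_0^\infty\eta'(t)^2t\,dt$, is $+\infty$ if $\sqrt\rho$, respectively $\eta$, has no weak gradient. An inequality $T\ge A-B$ between such quantities means $T+B\ge A$, and $A/\infty=0=0\cdot\infty$. -/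

import Mathlib

open MeasureTheory Set
open scoped ENNReal ContDiff SchwartzMap LineDeriv

noncomputable section

namespace LiebThirring

/-! ### Operators on `L²(ℝᵈ)` -/

/-- The configuration space `ℝᵈ` with its Euclidean norm. -/
abbrev Space (d : ℕ) : Type := EuclideanSpace ℝ (Fin d)

/-- The Hilbert space `L²(ℝᵈ)` of complex-valued functions, with Lebesgue measure. -/
abbrev L2 (d : ℕ) : Type := Lp ℂ 2 (volume : Measure (Space d))

/-- The trace in `[0, ∞]` of a nonnegative quadratic form `q` whose domain `D` is mapped into the
Hilbert space `H` by `emb`: the supremum of `∑ᵢ q(vᵢ)` over all finite orthonormal families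
`vᵢ` in the form domain. -/
def formTrace {H D : Type*} [NormedAddCommGroup H] [InnerProductSpace ℂ H]
    (emb : D → H) (q : D → ℝ) : ℝ≥0∞ :=
  ⨆ (n : ℕ) (v : Fin n → D) (_ : Orthonormal ℂ (fun i => emb (v i))),
    ∑ i, ENNReal.ofReal (q (v i))

/-- The trace in `[0, ∞]` of a bounded positive operator. A positive operator is trace class
if and only if this is finite. -/
def opTrace {H : Type*} [NormedAddCommGroup H] [InnerProductSpace ℂ H]
    (T : H →L[ℂ] H) : ℝ≥0∞ :=
  formTrace (fun v : H => v) (fun v => (inner ℂ v (T v)).re)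

/-- Multiplication by the indicator function of a measurable set `A`, on `L²(ℝᵈ)`. -/
def restrictTo {d : ℕ} {A : Set (Space d)} (hA : MeasurableSet A) (f : L2 d) : L2 d :=
  MemLp.toLp (A.indicator (f : Space d → ℂ)) ((Lp.memLp f).indicator hA)

/-- `ρ` is the density (the diagonal of the integral kernel) of the positive operator `γ`:
`∫_A ρ = Tr (1_A γ 1_A)` for all measurable sets `A`. This determines `ρ` almost everywhere when
`γ` is trace class. -/
structure IsDensity {d : ℕ} (γ : L2 d →L[ℂ] L2 d) (ρ : Space d → ℝ) : Prop where
  aestronglyMeasurable : AEStronglyMeasurable ρ volume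
  nonneg : ∀ᵐ x, 0 ≤ ρ x
  lintegral_eq : ∀ (A : Set (Space d)) (hA : MeasurableSet A),
    ∫⁻ x in A, ENNReal.ofReal (ρ x) =
      formTrace (fun f : L2 d => f)
        (fun f => (inner ℂ (restrictTo hA f) (γ (restrictTo hA f))).re)

/-- The kinetic energy `Tr (-Δ) γ ∈ [0, ∞]`, that is, the trace of the positive operator
`-∇γ∇ = -∑ⱼ ∂ⱼ γ ∂ⱼ`, given by the quadratic form `f ↦ ∑ⱼ ⟨∂ⱼ f, γ ∂ⱼ f⟩` on Schwartz functions. -/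
def kineticEnergy {d : ℕ} (γ : L2 d →L[ℂ] L2 d) : ℝ≥0∞ :=
  formTrace (fun f : 𝓢(Space d, ℂ) => f.toLp 2 volume)
    (fun f => ∑ j : Fin d,
      (inner ℂ ((∂_{EuclideanSpace.single j (1 : ℝ)} f).toLp 2 volume)
        (γ ((∂_{EuclideanSpace.single j (1 : ℝ)} f).toLp 2 volume))).re)

/-! ### Weak gradients and Dirichlet integrals -/

section WeakGradient

variable {E : Type*} [NormedAddCommGroup E] [InnerProductSpace ℝ E] [MeasureSpace E]

/-- `G` is the weak (distributional) gradient of `u` on the open set `Ω`. -/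
structure HasWeakGradientOn (Ω : Set E) (u : E → ℝ) (G : E → E) : Prop where
  locallyIntegrableOn : LocallyIntegrableOn u Ω
  locallyIntegrableOn_grad : LocallyIntegrableOn G Ω
  integral_eq : ∀ φ : E → ℝ, ContDiff ℝ ∞ φ → HasCompactSupport φ → tsupport φ ⊆ Ω →
    ∀ v : E, ∫ x in Ω, u x * fderiv ℝ φ x v = -∫ x in Ω, φ x * inner ℝ (G x) v

/-- The weighted Dirichlet integral `∫_Ω |∇u(x)|² w(x) dx ∈ [0, ∞]`, with `∇u` the weak gradient
(unique almost everywhere). It is `∞` if `u` has no weak gradient on `Ω`. -/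
def dirichletIntegral (Ω : Set E) (w : E → ℝ) (u : E → ℝ) : ℝ≥0∞ :=
  ⨅ (G : E → E) (_ : HasWeakGradientOn Ω u G), ∫⁻ x in Ω, ENNReal.ofReal (‖G x‖ ^ 2 * w x)

end WeakGradient

/-- `∫_{ℝᵈ} |∇u|²`. -/
def gradientEnergy {d : ℕ} (u : Space d → ℝ) : ℝ≥0∞ :=
  dirichletIntegral univ (fun _ => 1) u

/-- `∫₀^∞ η'(t)² t dt`. -/
def radialEnergy (η : ℝ → ℝ) : ℝ≥0∞ :=
  dirichletIntegral (Ioi (0 : ℝ)) (fun t => t) η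

/-! ### The profile function -/

/-- The normalization `∫₀^∞ η(t)² dt/t = 1 = ∫₀^∞ η(t)² t dt`. Only the values of `η` on `(0, ∞)`
matter. -/
structure IsNormalized (η : ℝ → ℝ) : Prop where
  aestronglyMeasurable : AEStronglyMeasurable η (volume.restrict (Ioi (0 : ℝ)))
  lintegral_div : ∫⁻ t in Ioi (0 : ℝ), ENNReal.ofReal (η t ^ 2 / t) = 1
  lintegral_mul : ∫⁻ t in Ioi (0 : ℝ), ENNReal.ofReal (η t ^ 2 * t) = 1

/-- The moment `∫₀^∞ η(t)² t^{d+1} dt ∈ [0, ∞]`. -/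
def moment (d : ℕ) (η : ℝ → ℝ) : ℝ≥0∞ :=
  ∫⁻ t in Ioi (0 : ℝ), ENNReal.ofReal (η t ^ 2 * t ^ (d + 1))

/-- The Gaussian in `log t`: `(πε)^{-1/4} exp (-(ε/2 + ln t)² / (2ε))`. -/
def gaussianProfile (ε : ℝ) (t : ℝ) : ℝ :=
  (Real.pi * ε) ^ (-(1 / 4) : ℝ) * Real.exp (-(ε / 2 + Real.log t) ^ 2 / (2 * ε))

/-- The semiclassical Thomas–Fermi constant `4π (d/(d+2)) Γ(1+d/2)^{2/d}`. -/
def thomasFermi (d : ℕ) : ℝ :=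
  4 * Real.pi * ((d : ℝ) / ((d : ℝ) + 2)) * Real.Gamma (1 + (d : ℝ) / 2) ^ (2 / (d : ℝ))

/-- `∫_{ℝᵈ} ρ^{1+2/d} ∈ [0, ∞]`. -/
def thomasFermiIntegral {d : ℕ} (ρ : Space d → ℝ) : ℝ≥0∞ :=
  ∫⁻ x, ENNReal.ofReal (ρ x ^ (1 + 2 / (d : ℝ)))

end LiebThirring

end

open LiebThirring

open Filter Topology

noncomputable section

/-! The proof localizes `γ` at a scale set by its own density. Write `f(r) = η(eʳ)`; the two
normalizations become `∫ f² = 1` and `∫ e^{2r} f² = 1`, the moment becomes `M = ∫ e^{(d+2)r} f²`,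
and `∫ η'(t)² t dt` becomes `R = ∫ f'²`. Put `χ_r(x) = f(r - ln ρ(x) / d)` and consider `χ_r γ χ_r`
for every real `r`.

Upper bound. Since `∫ χ_r² dr = 1` on `{ρ > 0}`, the IMS formula gives that the kinetic energies of
`χ_r γ χ_r`, integrated over `r`, amount to at most `Tr(-Δ)γ + R ∫ ρ |∇ ln ρ|² / d²`, and `ρ |∇ ln
ρ|² = 4 |∇√ρ|²`.

Lower bound. As `γ ≤ 1`, Bessel's inequality for plane waves times `χ_r` bounds the momentum
distribution of `χ_r γ χ_r` by `‖χ_r‖²`. The bathtub estimate with threshold `m = c e^{2r}` bounds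
its kinetic energy below by `m ∫ χ_r² ρ - L m^{1+d/2} ‖χ_r‖²`, where `L` is `phaseSpaceConst`.
Integrated over `r`, both terms become multiples of `∫ ρ^{1+2/d}`, with total factor `c - L M
c^{1+d/2}`. The best `c` yields the Thomas–Fermi constant divided by `M^{2/d}`.

Two devices make this rigorous for weak derivatives. Difference quotients replace derivatives
throughout, so that no chain rule for `χ_r` is needed (`tsum_lintegral_localized_sub_le`); Fatou's
lemma removes the step size (`bathtub_le_liminf`). In the cutoff, `ρ` is replaced by `min ρ K`,
which makes the subtracted term finite (`localized_kinetic_bound`); then `K → ∞`. -/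

namespace LiebThirring

/-! ### Traces of quadratic forms and rank one decompositions. -/

section HilbertSpace

variable {H : Type*} [NormedAddCommGroup H] [InnerProductSpace ℂ H]

lemma sum_enorm_inner_sq_le {n : ℕ} {v : Fin n → H} (hv : Orthonormal ℂ v) (g : H) :
    ∑ j, ‖inner ℂ g (v j)‖ₑ ^ 2 ≤ ‖g‖ₑ ^ 2 := by
  have h := hv.sum_inner_products_le (s := Finset.univ) g
  have h2 : ∀ j, ‖inner ℂ g (v j)‖ₑ ^ 2 = ENNReal.ofReal (‖inner ℂ (v j) g‖ ^ 2) := by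
    intro j
    rw [← norm_inner_symm, ENNReal.ofReal_pow (norm_nonneg _), ofReal_norm]
  simp_rw [h2]
  rw [← ENNReal.ofReal_sum_of_nonneg (fun _ _ => by positivity), ← ofReal_norm,
    ← ENNReal.ofReal_pow (norm_nonneg _)]
  exact ENNReal.ofReal_le_ofReal h

/-- Bessel's inequality for each `g i`, after exchanging the two sums. -/
lemma formTrace_le_tsum {D ι : Type*} (emb : D → H) (q : D → ℝ) (g : ι → H)
    (hq : ∀ v, ENNReal.ofReal (q v) ≤ ∑' i, ‖inner ℂ (g i) (emb v)‖ₑ ^ 2) :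
    formTrace emb q ≤ ∑' i, ‖g i‖ₑ ^ 2 := by
  refine iSup_le fun n => iSup_le fun v => iSup_le fun hv => ?_
  calc ∑ j, ENNReal.ofReal (q (v j)) ≤ ∑ j, ∑' i, ‖inner ℂ (g i) (emb (v j))‖ₑ ^ 2 :=
        Finset.sum_le_sum fun j _ => hq _
    _ = ∑' i, ∑ j, ‖inner ℂ (g i) (emb (v j))‖ₑ ^ 2 :=
        (Summable.tsum_finsetSum fun _ _ => ENNReal.summable).symm
    _ ≤ ∑' i, ‖g i‖ₑ ^ 2 := ENNReal.tsum_le_tsum fun i => sum_enorm_inner_sq_le hv _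

/-- A dense subspace of the form domain suffices: finitely many `g i` are approximated within `ε /
2` by vectors of `S`, and an orthonormal basis of the span of these is an admissible family. The
projection of `g i` on that span has norm at least `‖g i‖ - ε`; then `ε → 0`. Density is what allows
the kinetic energy to be tested on Schwartz functions only. -/
lemma tsum_le_formTrace {D ι : Type*} (emb : D → H) (S : Submodule ℂ H)
    (hS : ∀ x ∈ S, ∃ v, emb v = x) (hdense : Dense (S : Set H)) (q : D → ℝ) (g : ι → H)
    (hq : ∀ v, ∑' i, ‖inner ℂ (g i) (emb v)‖ₑ ^ 2 ≤ ENNReal.ofReal (q v)) :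
    ∑' i, ‖g i‖ₑ ^ 2 ≤ formTrace emb q := by
  rw [ENNReal.tsum_eq_iSup_sum]
  refine iSup_le fun s => ?_
  have key : ∀ ε : ℝ, 0 < ε →
      ∑ i ∈ s, ENNReal.ofReal (‖g i‖ - ε) ^ 2 ≤ formTrace emb q := by
    intro ε hε
    have happ : ∀ i, ∃ x ∈ S, ‖g i - x‖ < ε / 2 := by
      intro i
      obtain ⟨x, hx, h⟩ := Metric.mem_closure_iff.1 (hdense (g i)) (ε / 2) (half_pos hε)
      exact ⟨x, hx, by rwa [dist_eq_norm] at h⟩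
    choose x hxS hx using happ
    classical
    let V : Submodule ℂ H := Submodule.span ℂ (s.image x : Set H)
    have hVS : V ≤ S := Submodule.span_le.2 (by
      intro y hy
      obtain ⟨i, -, rfl⟩ := Finset.mem_image.1 (Finset.mem_coe.1 hy)
      exact hxS i)
    have : FiniteDimensional ℂ V := FiniteDimensional.span_finset ℂ _
    let b := stdOrthonormalBasis ℂ V
    have hb : ∀ j, ∃ v, emb v = (b j : H) := fun j => hS _ (hVS (b j).2)
    choose v hv using hb
    have hon : Orthonormal ℂ (fun j => emb (v j)) := by
      have : (fun j => emb (v j)) = fun j => V.subtypeₗᵢ (b j) := by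
        funext j; rw [hv]; rfl
      rw [this]
      exact b.orthonormal.comp_linearIsometry V.subtypeₗᵢ
    have hterm : ∀ i ∈ s, ENNReal.ofReal (‖g i‖ - ε) ^ 2 ≤
        ∑ j, ‖inner ℂ (g i) (emb (v j))‖ₑ ^ 2 := by
      intro i hi
      have hproj : ∑ j, ‖inner ℂ (g i) (emb (v j))‖ ^ 2 = ‖V.orthogonalProjectionOnto (g i)‖ ^ 2 := by
        rw [← b.sum_sq_norm_inner_left (V.orthogonalProjectionOnto (g i))]
        refine Finset.sum_congr rfl fun j _ => ?_
        rw [hv, Submodule.inner_orthogonalProjectionOnto_eq_of_mem_right]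
      have hge : ‖g i‖ - ε ≤ ‖V.orthogonalProjectionOnto (g i)‖ := by
        have hxV : x i ∈ V :=
          Submodule.subset_span (Finset.mem_coe.2 (Finset.mem_image_of_mem x hi))
        have h1 : ‖V.orthogonalProjectionOnto (g i - x i)‖ ≤ ‖g i - x i‖ :=
          Submodule.norm_orthogonalProjectionOnto_apply_le _ _
        have h2 : V.orthogonalProjectionOnto (x i) = ⟨x i, hxV⟩ :=
          Submodule.orthogonalProjectionOnto_mem_subspace_eq_self (⟨x i, hxV⟩ : V)
        rw [map_sub, h2] at h1
        have h3 := norm_sub_norm_le (⟨x i, hxV⟩ : V) (V.orthogonalProjectionOnto (g i))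
        rw [norm_sub_rev] at h3
        have h4 := norm_sub_norm_le (g i) (x i)
        have h5 : ‖(⟨x i, hxV⟩ : V)‖ = ‖x i‖ := rfl
        linarith [hx i]
      have h6 : ∑ j, ‖inner ℂ (g i) (emb (v j))‖ₑ ^ 2 =
          ENNReal.ofReal ‖V.orthogonalProjectionOnto (g i)‖ ^ 2 := by
        rw [← ENNReal.ofReal_pow (norm_nonneg _), ← hproj,
          ENNReal.ofReal_sum_of_nonneg (fun _ _ => by positivity)]
        refine Finset.sum_congr rfl fun j _ => ?_
        rw [ENNReal.ofReal_pow (norm_nonneg _), ofReal_norm]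
      rw [h6]
      gcongr
    calc ∑ i ∈ s, ENNReal.ofReal (‖g i‖ - ε) ^ 2
        ≤ ∑ i ∈ s, ∑ j, ‖inner ℂ (g i) (emb (v j))‖ₑ ^ 2 := Finset.sum_le_sum hterm
      _ = ∑ j, ∑ i ∈ s, ‖inner ℂ (g i) (emb (v j))‖ₑ ^ 2 := Finset.sum_comm
      _ ≤ ∑ j, ENNReal.ofReal (q (v j)) :=
        Finset.sum_le_sum fun j _ => (ENNReal.sum_le_tsum s).trans (hq _)
      _ ≤ formTrace emb q := le_iSup_of_le _ (le_iSup_of_le v (le_iSup_of_le hon le_rfl))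
  have hlim : Tendsto (fun ε : ℝ => ∑ i ∈ s, ENNReal.ofReal (‖g i‖ - ε) ^ 2) (𝓝[>] 0)
      (𝓝 (∑ i ∈ s, ENNReal.ofReal (‖g i‖ - 0) ^ 2)) := by
    refine tendsto_finsetSum _ fun i _ => ?_
    refine (ENNReal.Tendsto.pow ?_)
    refine (ENNReal.continuous_ofReal.tendsto _).comp ?_
    exact ((continuous_const.sub continuous_id).tendsto 0).mono_left nhdsWithin_le_nhds
  simp_rw [sub_zero, ofReal_norm] at hlim
  exact le_of_tendsto hlim (eventually_mem_nhdsWithin.mono fun ε hε => key ε hε)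

variable [CompleteSpace H]

/-- A positive trace class operator is a countable sum of (not necessarily orthogonal) rank one
operators. -/
lemma exists_rankOne_decomposition (γ : H →L[ℂ] H) (hγ : 0 ≤ γ) (htr : opTrace γ ≠ ⊤) :
    ∃ u : ℕ → H,
      (∀ f, ENNReal.ofReal (inner ℂ f (γ f)).re = ∑' i, ‖inner ℂ (u i) f‖ₑ ^ 2) ∧
      ∑' i, ‖u i‖ₑ ^ 2 ≠ ⊤ := by
  -- With `B = √γ` and a Hilbert basis `b`, Parseval's identity for `B f` gives `⟨f, γ f⟩ = ∑ |⟨B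
  -- bᵢ, f⟩|²`, so the vectors are `B bᵢ`.
  obtain ⟨w, b, -⟩ := exists_hilbertBasis ℂ H
  let B := CFC.sqrt γ
  have hBB : B * B = γ := CFC.sqrt_mul_sqrt_self γ hγ
  have hBsa : ∀ x y, inner ℂ (B x) y = inner ℂ x (B y) := by
    have : (CFC.sqrt γ).IsPositive :=
      (ContinuousLinearMap.nonneg_iff_isPositive _).1 (CFC.sqrt_nonneg γ)
    exact this.isSelfAdjoint.isSymmetric
  have hnorm : ∀ f, ENNReal.ofReal (inner ℂ f (γ f)).re = ‖B f‖ₑ ^ 2 := by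
    intro f
    rw [← hBB, mul_apply_eq_comp, ← hBsa, ← ofReal_norm,
      ← ENNReal.ofReal_pow (norm_nonneg _)]
    congr 1
    exact inner_self_eq_norm_sq (𝕜 := ℂ) (B f)
  have hpars : ∀ x : H, ‖x‖ₑ ^ 2 = ∑' i, ‖inner ℂ (b i) x‖ₑ ^ 2 := by
    intro x
    have h := b.hasSum_inner_mul_inner x x
    have h2 : ∀ i, inner ℂ x (b i) * inner ℂ (b i) x = ((‖inner ℂ (b i) x‖ ^ 2 : ℝ) : ℂ) := by
      intro i
      rw [← inner_conj_symm x, Complex.conj_mul']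
      push_cast
      rfl
    simp_rw [h2, inner_self_eq_norm_sq_to_K] at h
    have h3 : HasSum (fun i => ‖inner ℂ (b i) x‖ ^ 2) (‖x‖ ^ 2) := by
      have h4 : ((‖x‖ : ℂ) ^ 2) = ((‖x‖ ^ 2 : ℝ) : ℂ) := by push_cast; rfl
      exact Complex.hasSum_ofReal.1 (h4 ▸ h)
    rw [← ofReal_norm, ← ENNReal.ofReal_pow (norm_nonneg _), ← h3.tsum_eq,
      ENNReal.ofReal_tsum_of_nonneg (fun _ => by positivity) h3.summable]
    refine tsum_congr fun i => ?_
    rw [ENNReal.ofReal_pow (norm_nonneg _), ofReal_norm]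
  have hu : ∀ f, ENNReal.ofReal (inner ℂ f (γ f)).re = ∑' i, ‖inner ℂ (B (b i)) f‖ₑ ^ 2 := by
    intro f
    rw [hnorm, hpars]
    simp_rw [hBsa]
  have hfin : ∑' i, ‖B (b i)‖ₑ ^ 2 ≠ ⊤ := by
    refine ne_top_of_le_ne_top htr ?_
    refine tsum_le_formTrace _ ⊤ (fun x _ => ⟨x, rfl⟩) (by simp) _ _ fun v => ?_
    rw [hu]
  -- The basis may be uncountable, but a finite sum has countable support, so the nonzero vectors
  -- can be indexed by `ℕ` and padded with zeros.
  have hc : (Function.support fun i => ‖B (b i)‖ₑ ^ 2).Countable :=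
    Summable.countable_support_ennreal hfin
  have hinj : ∃ e : (Function.support fun i => ‖B (b i)‖ₑ ^ 2) → ℕ, Function.Injective e :=
    hc.to_subtype.exists_injective_nat
  obtain ⟨e, he⟩ := hinj
  have hext : ∀ F : H → ℝ≥0∞, F 0 = 0 →
      ∑' n, F (Function.extend e (fun i => B (b i)) 0 n) = ∑' i, F (B (b i)) := by
    intro F hF
    have h1 : ∀ n, F (Function.extend e (fun i => B (b i)) 0 n) =
        Function.extend e (fun i => F (B (b i))) 0 n := by
      intro n
      by_cases hn : ∃ a, e a = n
      · obtain ⟨a, rfl⟩ := hn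
        simp [he.extend_apply]
      · simp [Function.extend_apply' _ _ _ hn, hF]
    simp_rw [h1]
    rw [tsum_extend_zero he]
    refine tsum_subtype_eq_of_support_subset (f := fun i => F (B (b i))) ?_
    intro i hi
    simp only [Function.mem_support] at hi ⊢
    intro h0
    apply hi
    have : B (b i) = 0 := by simpa using h0
    rw [this, hF]
  refine ⟨Function.extend e (fun i => B (b i)) 0, fun f => ?_, ?_⟩
  · rw [hext (fun x => ‖inner ℂ x f‖ₑ ^ 2) (by simp), hu]
  · rw [hext (fun x => ‖x‖ₑ ^ 2) (by simp)]
    exact hfin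

end HilbertSpace

/-! ### Density and weak derivatives of the rank one components. -/

lemma eLpNorm_two_sq {α F : Type*} [MeasurableSpace α] [NormedAddCommGroup F] (f : α → F)
    (μ : Measure α) : eLpNorm f 2 μ ^ 2 = ∫⁻ x, ‖f x‖ₑ ^ 2 ∂μ := by
  simpa using eLpNorm_nnreal_pow_eq_lintegral (μ := μ) (f := f) (p := 2) two_ne_zero

lemma Lp_enorm_sq {α F : Type*} [MeasurableSpace α] [NormedAddCommGroup F] {μ : Measure α}
    (f : Lp F 2 μ) : ‖f‖ₑ ^ 2 = ∫⁻ x, ‖f x‖ₑ ^ 2 ∂μ := by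
  rw [Lp.enorm_def, eLpNorm_two_sq]

variable {d : ℕ}

lemma inner_restrictTo {A : Set (Space d)} (hA : MeasurableSet A) (u f : L2 d) :
    inner ℂ u (restrictTo hA f) = inner ℂ (restrictTo hA u) f := by
  rw [L2.inner_def, L2.inner_def]
  refine integral_congr_ae ?_
  filter_upwards [((Lp.memLp f).indicator hA).coeFn_toLp, ((Lp.memLp u).indicator hA).coeFn_toLp]
    with x hf hu
  simp only [restrictTo, hf, hu]
  by_cases hx : x ∈ A <;> simp [hx]

/-- The density of `γ = ∑ₙ |uₙ⟩⟨uₙ|` is `∑ₙ |uₙ|²`. -/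
lemma IsDensity.ae_eq_tsum {γ : L2 d →L[ℂ] L2 d} {ρ : Space d → ℝ} (hρ : IsDensity γ ρ)
    {u : ℕ → L2 d}
    (hu : ∀ f, ENNReal.ofReal (inner ℂ f (γ f)).re = ∑' n, ‖inner ℂ (u n) f‖ₑ ^ 2) :
    ∀ᵐ x, ENNReal.ofReal (ρ x) = ∑' n, ‖u n x‖ₑ ^ 2 := by
  have hmeas : ∀ n, Measurable fun x => ‖u n x‖ₑ ^ 2 := fun n =>
    ((Lp.stronglyMeasurable (u n)).measurable.enorm).pow_const 2
  have hset : ∀ A : Set (Space d), MeasurableSet A →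
      ∫⁻ x in A, ENNReal.ofReal (ρ x) = ∫⁻ x in A, ∑' n, ‖u n x‖ₑ ^ 2 := by
    intro A hA
    rw [hρ.lintegral_eq A hA, lintegral_tsum fun n => (hmeas n).aemeasurable]
    have hq : ∀ f : L2 d, ENNReal.ofReal (inner ℂ (restrictTo hA f) (γ (restrictTo hA f))).re =
        ∑' n, ‖inner ℂ (restrictTo hA (u n)) f‖ₑ ^ 2 := by
      intro f
      simp_rw [hu, inner_restrictTo]
    have hnorm : ∀ n, ‖restrictTo hA (u n)‖ₑ ^ 2 = ∫⁻ x in A, ‖u n x‖ₑ ^ 2 := by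
      intro n
      rw [restrictTo, Lp.enorm_toLp, eLpNorm_indicator_eq_eLpNorm_restrict hA, eLpNorm_two_sq]
    simp_rw [← hnorm]
    exact le_antisymm (formTrace_le_tsum _ _ _ fun f => (hq f).le)
      (tsum_le_formTrace _ ⊤ (fun x _ => ⟨x, rfl⟩) (by simp) _ _ fun f => (hq f).ge)
  have hρm : AEMeasurable (fun x => ENNReal.ofReal (ρ x)) :=
    hρ.aestronglyMeasurable.aemeasurable.ennreal_ofReal
  have h := ae_eq_of_forall_setLIntegral_eq_of_sigmaFinite hρm.measurable_mk
    (Measurable.tsum hmeas) (fun A hA _ => by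
      rw [← hset A hA]
      exact lintegral_congr_ae (ae_restrict_of_ae hρm.ae_eq_mk.symm))
  filter_upwards [hρm.ae_eq_mk, h] with x h1 h2
  rw [h1, h2]

/-- If `γ = ∑ₙ |uₙ⟩⟨uₙ|` has finite kinetic energy, then the `uₙ` have weak derivatives in `L²`. -/
lemma exists_weakDeriv_of_kineticEnergy_ne_top {γ : L2 d →L[ℂ] L2 d} {u : ℕ → L2 d}
    (hγ : 0 ≤ γ)
    (hu : ∀ f, ENNReal.ofReal (inner ℂ f (γ f)).re = ∑' n, ‖inner ℂ (u n) f‖ₑ ^ 2)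
    (hT : kineticEnergy γ ≠ ⊤) :
    ∃ g : ℕ → Fin d → L2 d,
      (∀ n j (f : 𝓢(Space d, ℂ)),
        inner ℂ (u n) ((∂_{EuclideanSpace.single j (1 : ℝ)} f).toLp 2 volume) =
          -inner ℂ (g n j) (f.toLp 2 volume)) ∧
      ∑' n, ∑ j, ‖g n j‖ₑ ^ 2 ≤ kineticEnergy γ := by
  have hpos : ∀ f : L2 d, 0 ≤ (inner ℂ f (γ f)).re := fun f =>
    ((ContinuousLinearMap.nonneg_iff_isPositive γ).1 hγ).re_inner_nonneg_right f
  set D : Fin d → 𝓢(Space d, ℂ) →L[ℂ] L2 d := fun j =>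
    (SchwartzMap.toLpCLM ℂ ℂ 2 volume).comp
      (LineDeriv.lineDerivOpCLM ℂ 𝓢(Space d, ℂ) (EuclideanSpace.single j (1 : ℝ))) with hD
  have hDapp : ∀ j f, D j f = (∂_{EuclideanSpace.single j (1 : ℝ)} f).toLp 2 volume :=
    fun j f => rfl
  have hq : ∀ f : 𝓢(Space d, ℂ), ENNReal.ofReal (∑ j : Fin d,
      (inner ℂ ((∂_{EuclideanSpace.single j (1 : ℝ)} f).toLp 2 volume)
        (γ ((∂_{EuclideanSpace.single j (1 : ℝ)} f).toLp 2 volume))).re) =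
      ∑ j, ∑' n, ‖inner ℂ (u n) (D j f)‖ₑ ^ 2 := by
    intro f
    rw [ENNReal.ofReal_sum_of_nonneg fun j _ => hpos _]
    simp_rw [hu, hDapp]
  -- A single normalized Schwartz function is an admissible family in the supremum defining the
  -- kinetic energy. Hence `f ↦ ⟨uₙ, ∂ⱼ f⟩` is bounded in the `L²` norm, extends to `L²` by density,
  -- and is represented by a vector by the Riesz theorem.
  have hbound1 : ∀ (f : 𝓢(Space d, ℂ)) n j, ‖f.toLp 2 volume‖ = 1 →
      ‖inner ℂ (u n) (D j f)‖ₑ ^ 2 ≤ kineticEnergy γ := by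
    intro f n j hf
    have h1 : ENNReal.ofReal (∑ j : Fin d,
      (inner ℂ ((∂_{EuclideanSpace.single j (1 : ℝ)} f).toLp 2 volume)
        (γ ((∂_{EuclideanSpace.single j (1 : ℝ)} f).toLp 2 volume))).re) ≤ kineticEnergy γ := by
      refine le_iSup_of_le 1 (le_iSup_of_le (fun _ => f) (le_iSup_of_le ?_ ?_))
      · rw [orthonormal_iff_ite]
        intro i j
        rw [Subsingleton.elim i j, if_pos rfl, inner_self_eq_norm_sq_to_K, hf]
        simp
      · simp
    rw [hq] at h1
    refine le_trans ?_ h1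
    refine le_trans ?_ (Finset.single_le_sum (f := fun j => ∑' n, ‖inner ℂ (u n) (D j f)‖ₑ ^ 2)
      (fun _ _ => zero_le) (Finset.mem_univ j))
    exact ENNReal.le_tsum n
  have hbound : ∀ (f : 𝓢(Space d, ℂ)) n j,
      ‖inner ℂ (u n) (D j f)‖ ≤ √(kineticEnergy γ).toReal * ‖f.toLp 2 volume‖ := by
    intro f n j
    set N := ‖f.toLp 2 volume‖ with hN
    rcases eq_or_ne N 0 with h0 | h0
    · have : f = 0 := by
        refine SchwartzMap.injective_toLp 2 volume ?_
        refine (norm_eq_zero.1 (hN.symm.trans h0)).trans ?_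
        exact ((SchwartzMap.toLpCLM ℂ ℂ 2 volume).map_zero).symm
      simp [this, h0]
    · have h1 := hbound1 ((N⁻¹ : ℂ) • f) n j (by
        have : ((N⁻¹ : ℂ) • f).toLp 2 volume = (N⁻¹ : ℂ) • f.toLp 2 volume :=
          (SchwartzMap.toLpCLM ℂ ℂ 2 volume).map_smul _ _
        rw [this, norm_smul, ← hN, norm_inv, Complex.norm_real, Real.norm_eq_abs,
          abs_of_nonneg (hN ▸ norm_nonneg _), inv_mul_cancel₀ h0])
      rw [map_smul, inner_smul_right, ← ofReal_norm, ← ENNReal.ofReal_pow (norm_nonneg _),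
        ENNReal.ofReal_le_iff_le_toReal hT, norm_mul, norm_inv, Complex.norm_real,
        Real.norm_eq_abs, abs_of_nonneg (hN ▸ norm_nonneg _)] at h1
      have h2 := Real.abs_le_sqrt h1
      have hNpos : 0 < N := lt_of_le_of_ne (hN ▸ norm_nonneg _) h0.symm
      rw [abs_of_nonneg (by positivity), inv_mul_le_iff₀ hNpos] at h2
      linarith
  have hdense : DenseRange (SchwartzMap.toLpCLM ℂ ℂ 2 (volume : Measure (Space d))) :=
    SchwartzMap.denseRange_toLpCLM (F := ℂ) (p := 2) ENNReal.ofNat_ne_top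
  have hex : ∀ n j, ∃ g : L2 d, ∀ f : 𝓢(Space d, ℂ),
      inner ℂ (u n) (D j f) = -inner ℂ g (f.toLp 2 volume) := by
    intro n j
    let ℓ : L2 d →L[ℂ] ℂ := LinearMap.extendOfNorm
      ((innerSL ℂ (u n)).comp (D j)).toLinearMap
      (SchwartzMap.toLpCLM ℂ ℂ 2 (volume : Measure (Space d))).toLinearMap
    refine ⟨-(InnerProductSpace.toDual ℂ (L2 d)).symm ℓ, fun f => ?_⟩
    rw [inner_neg_left, neg_neg, InnerProductSpace.toDual_symm_apply]
    exact (LinearMap.extendOfNorm_eq (f := ((innerSL ℂ (u n)).comp (D j)).toLinearMap)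
      hdense ⟨√(kineticEnergy γ).toReal, fun f => hbound f n j⟩ f).symm
  choose g hg using hex
  refine ⟨g, hg, ?_⟩
  have hsum := tsum_le_formTrace (fun f : 𝓢(Space d, ℂ) => f.toLp 2 volume)
    (LinearMap.range (SchwartzMap.toLpCLM ℂ ℂ 2 (volume : Measure (Space d))).toLinearMap)
    (fun x hx => hx) hdense _ (fun p : ℕ × Fin d => g p.1 p.2) (fun f => by
      rw [hq, ENNReal.tsum_prod', ← Summable.tsum_finsetSum fun _ _ => ENNReal.summable]
      refine ENNReal.tsum_le_tsum fun n => ?_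
      rw [tsum_fintype]
      refine Finset.sum_le_sum fun j _ => ?_
      rw [hg, enorm_neg])
  rw [ENNReal.tsum_prod'] at hsum
  simp only [tsum_fintype] at hsum
  exact hsum

/-! ### Weak derivatives and translations in `L²`. -/

section Translation

variable {E : Type*} [NormedAddCommGroup E] [InnerProductSpace ℝ E] [FiniteDimensional ℝ E]
  [MeasurableSpace E] [BorelSpace E]

lemma abs_integral_mul_le {α : Type*} [MeasurableSpace α] {μ : Measure α} {f g : α → ℝ}
    (hf : MemLp f 2 μ) (hg : MemLp g 2 μ) :
    |∫ x, f x * g x ∂μ| ≤ (eLpNorm f 2 μ).toReal * (eLpNorm g 2 μ).toReal := by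
  have h := abs_real_inner_le_norm hf.toLp hg.toLp
  rw [L2.inner_def, Lp.norm_toLp, Lp.norm_toLp] at h
  convert h using 2
  refine integral_congr_ae ?_
  filter_upwards [hf.coeFn_toLp, hg.coeFn_toLp] with x h1 h2
  rw [h1, h2]
  simp [mul_comm]

lemma dense_smooth_compactSupport :
    Dense {f : Lp ℝ 2 (volume : Measure E) | ∃ φ : E → ℝ, ContDiff ℝ ∞ φ ∧
      HasCompactSupport φ ∧ f =ᵐ[volume] φ} := by
  intro f
  rw [Metric.mem_closure_iff]
  intro ε hε
  obtain ⟨φ, hφc, hφ, h⟩ := MemLp.exist_eLpNorm_sub_le (p := 2) ENNReal.ofNat_ne_top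
    one_le_two (Lp.memLp f) (half_pos hε)
  have hm : MemLp φ 2 (volume : Measure E) := hφ.continuous.memLp_of_hasCompactSupport hφc
  refine ⟨hm.toLp, ⟨φ, hφ, hφc, hm.coeFn_toLp⟩, ?_⟩
  rw [Lp.dist_def]
  have : eLpNorm (f - hm.toLp : E → ℝ) 2 volume = eLpNorm (f - φ : E → ℝ) 2 volume := by
    refine eLpNorm_congr_ae ?_
    filter_upwards [hm.coeFn_toLp] with x hx
    simp [hx]
  rw [this]
  refine lt_of_le_of_lt (ENNReal.toReal_mono ENNReal.ofReal_ne_top h) ?_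
  rw [ENNReal.toReal_ofReal (by positivity)]
  linarith

/-- The integral is the convolution of `u` with the reflected `φ` at the point `t • v`.
Differentiation falls on the smooth factor, and the weak derivative identity for the translated test
function turns the result into an integral against `g`. -/
lemma hasDerivAt_integral_translate {u g : E → ℝ} (hu : LocallyIntegrable u) (v : E)
    (h : ∀ φ : E → ℝ, ContDiff ℝ ∞ φ → HasCompactSupport φ →
      ∫ x, u x * fderiv ℝ φ x v = -∫ x, φ x * g x)
    {φ : E → ℝ} (hφ : ContDiff ℝ ∞ φ) (hφc : HasCompactSupport φ) (t : ℝ) :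
    HasDerivAt (fun t : ℝ => ∫ x, u x * φ (x - t • v)) (∫ x, φ (x - t • v) * g x) t := by
  set ψ : E → ℝ := fun z => φ (-z) with hψ
  have hψs : ContDiff ℝ ∞ ψ := hφ.comp contDiff_neg
  have hψc : HasCompactSupport ψ := hφc.comp_homeomorph (Homeomorph.neg E)
  have hc := HasCompactSupport.hasFDerivAt_convolution_right (μ := volume)
    (ContinuousLinearMap.mul ℝ ℝ) hψc hu (hψs.of_le (by simp)) (t • v)
  have hline : HasDerivAt (fun t : ℝ => t • v) v t := by
    simpa using (hasDerivAt_id t).smul_const v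
  have h1 := hc.comp_hasDerivAt t hline
  have hfun : (convolution u ψ (ContinuousLinearMap.mul ℝ ℝ) volume ∘ fun t : ℝ => t • v) =
      fun t : ℝ => ∫ x, u x * φ (x - t • v) := by
    funext s
    simp [convolution, hψ]
  rw [hfun] at h1
  refine h1.congr_deriv ?_
  rw [convolution_def, ContinuousLinearMap.integral_apply]
  · have h2 := h (fun x => φ (x - t • v)) (hφ.comp (contDiff_id.sub contDiff_const))
      (hφc.comp_homeomorph (Homeomorph.subRight (t • v)))
    rw [← neg_eq_iff_eq_neg, ← integral_neg] at h2
    rw [← h2]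
    refine integral_congr_ae (Eventually.of_forall fun x => ?_)
    have e1 : fderiv ℝ (fun x => φ (x - t • v)) x = fderiv ℝ φ (x - t • v) :=
      fderiv_comp_sub _
    have e2 : fderiv ℝ ψ (t • v - x) = -fderiv ℝ φ (x - t • v) := by
      have := (((hφ.differentiable (by simp) (-(t • v - x))).hasFDerivAt).comp (t • v - x)
        (hasFDerivAt_id (𝕜 := ℝ) (t • v - x)).neg).fderiv
      simp only [neg_sub] at this
      refine Eq.trans ?_ (this.trans (by ext; simp))
      rfl
    simp [e1, e2, ContinuousLinearMap.precompR_apply]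
  · exact (hψc.fderiv ℝ).convolutionExists_right
      (ContinuousLinearMap.precompR E (ContinuousLinearMap.mul ℝ ℝ)) hu
      ((hψs.continuous_fderiv (by simp))) (t • v)

/-- A function with weak derivative `g` in the direction `v` is Lipschitz in `L²` along `v`. -/
lemma lintegral_translate_sub_sq_le {u g : E → ℝ} (hu : MemLp u 2) (hg : MemLp g 2) (v : E)
    (h : ∀ φ : E → ℝ, ContDiff ℝ ∞ φ → HasCompactSupport φ →
      ∫ x, u x * fderiv ℝ φ x v = -∫ x, φ x * g x) (t : ℝ) :
    ∫⁻ x, ‖u (x + t • v) - u x‖ₑ ^ 2 ≤ ENNReal.ofReal (t ^ 2) * ∫⁻ x, ‖g x‖ₑ ^ 2 := by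
  have hmp : ∀ s : ℝ, MeasurePreserving (fun x : E => x - s • v) volume volume := fun s =>
    measurePreserving_sub_right volume _
  have hmp' : MeasurePreserving (fun x : E => x + t • v) volume volume :=
    measurePreserving_add_right volume _
  have hut : MemLp (fun x => u (x + t • v)) 2 := hu.comp_measurePreserving hmp'
  have hw : MemLp (fun x => u (x + t • v) - u x) 2 := hut.sub hu
  set C := |t| * (eLpNorm g 2 volume).toReal with hC
  have key : ∀ φ : E → ℝ, ContDiff ℝ ∞ φ → HasCompactSupport φ →
      |∫ x, φ x * (u (x + t • v) - u x)| ≤ C * (eLpNorm φ 2 volume).toReal := by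
    intro φ hφ hφc
    have hm : MemLp φ 2 (volume : Measure E) := hφ.continuous.memLp_of_hasCompactSupport hφc
    have hms : ∀ s : ℝ, MemLp (fun x => φ (x - s • v)) 2 := fun s =>
      hm.comp_measurePreserving (hmp s)
    have hbd : ∀ s : ℝ, ‖∫ x, φ (x - s • v) * g x‖ ≤
        (eLpNorm φ 2 volume).toReal * (eLpNorm g 2 volume).toReal := by
      intro s
      refine (abs_integral_mul_le (hms s) hg).trans_eq ?_
      congr 2
      exact eLpNorm_comp_measurePreserving hm.1 (hmp s)
    have hd := Convex.norm_image_sub_le_of_norm_hasDerivWithin_le (s := univ) (x := 0) (y := t)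
      (fun s _ => (hasDerivAt_integral_translate (hu.locallyIntegrable one_le_two) v h hφ hφc
        s).hasDerivWithinAt) (fun s _ => hbd s) convex_univ trivial trivial
    have heq : ∫ x, φ x * (u (x + t • v) - u x) =
        (∫ x, u x * φ (x - t • v)) - ∫ x, u x * φ (x - (0 : ℝ) • v) := by
      have e1 : ∫ x, u x * φ (x - t • v) = ∫ x, u (x + t • v) * φ x := by
        have := integral_add_right_eq_self (μ := volume) (fun x => u x * φ (x - t • v)) (t • v)
        rw [← this]
        simp
      have i1 : Integrable (fun x => u (x + t • v) * φ x) := hut.integrable_mul hm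
      have i2 : Integrable (fun x => u x * φ (x - (0 : ℝ) • v)) := hu.integrable_mul (hms 0)
      rw [e1, ← integral_sub i1 i2]
      refine integral_congr_ae (Eventually.of_forall fun x => ?_)
      simp only [zero_smul, sub_zero]
      ring
    rw [heq]
    refine hd.trans_eq ?_
    rw [hC, sub_zero, Real.norm_eq_abs]
    ring
  -- Duality: the bound for test functions extends to all of `L²` by density, and testing the
  -- difference against itself bounds its norm.
  have hall : ∀ f : Lp ℝ 2 (volume : Measure E), |inner ℝ f hw.toLp| ≤ C * ‖f‖ := by
    intro f
    have hcl : IsClosed {f : Lp ℝ 2 (volume : Measure E) | |inner ℝ f hw.toLp| ≤ C * ‖f‖} :=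
      isClosed_le (by fun_prop) (by fun_prop)
    refine closure_minimal ?_ hcl (dense_smooth_compactSupport f)
    rintro f ⟨φ, hφ, hφc, hfφ⟩
    have h1 := key φ hφ hφc
    rw [mem_ofPred_eq, L2.inner_def, Lp.norm_def, eLpNorm_congr_ae hfφ]
    convert h1 using 2
    refine integral_congr_ae ?_
    filter_upwards [hfφ, hw.coeFn_toLp] with x h1 h2
    rw [h1, h2]
    simp [mul_comm]
  have hnorm : ‖hw.toLp‖ ≤ C := by
    have h1 := hall hw.toLp
    rw [real_inner_self_eq_norm_sq, abs_of_nonneg (by positivity), sq] at h1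
    by_contra hlt
    have : 0 < ‖hw.toLp‖ := lt_of_le_of_lt (by positivity) (not_le.1 hlt)
    exact hlt (le_of_mul_le_mul_right h1 this)
  have h2 : ‖hw.toLp‖ₑ ^ 2 ≤ ENNReal.ofReal C ^ 2 := by
    rw [← ofReal_norm]
    gcongr
  rw [Lp.enorm_toLp, eLpNorm_two_sq] at h2
  refine h2.trans_eq ?_
  rw [hC, ENNReal.ofReal_mul (abs_nonneg _), ENNReal.ofReal_toReal hg.2.ne, mul_pow,
    eLpNorm_two_sq, ← ENNReal.ofReal_pow (abs_nonneg _), sq_abs]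

/-- A translation invariant square integrable function vanishes. -/
lemma lintegral_sq_eq_zero_of_translate_invariant {u : E → ℝ} (hu : MemLp u 2) {v : E}
    (hv : v ≠ 0)
    (h : ∀ t : ℝ, ∫⁻ x, ‖u (x + t • v) - u x‖ₑ ^ 2 = 0) : ∫⁻ x, ‖u x‖ₑ ^ 2 = 0 := by
  have hinv : ∀ t : ℝ, ∀ᵐ x, u (x + t • v) = u x := by
    intro t
    have hut : AEStronglyMeasurable (fun x => u (x + t • v)) volume :=
      hu.1.comp_measurePreserving (measurePreserving_add_right volume _)
    have := (lintegral_eq_zero_iff' ((hut.sub hu.1).enorm.pow_const 2)).1 (h t)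
    filter_upwards [this] with x hx
    simpa [sub_eq_zero] using hx
  have hfin : ∫⁻ x, ‖u x‖ₑ ^ 2 ≠ ⊤ := by
    rw [← eLpNorm_two_sq]
    exact ENNReal.pow_ne_top hu.2.ne
  have hball : ∀ R : ℝ, 0 < R → ∫⁻ x in Metric.ball (0 : E) R, ‖u x‖ₑ ^ 2 = 0 := by
    intro R hR
    -- The centres are at mutual distance at least `2 * R`, so the balls are disjoint. They all
    -- carry the same mass, and infinitely many of them fit into a finite total.
    set τ : ℕ → E := fun n => ((n : ℝ) * (2 * R / ‖v‖)) • v with hτ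
    have hset : ∀ n, ∫⁻ x in Metric.ball (τ n) R, ‖u x‖ₑ ^ 2 =
        ∫⁻ x in Metric.ball (0 : E) R, ‖u x‖ₑ ^ 2 := by
      intro n
      have hpre : (fun x : E => x + τ n) ⁻¹' Metric.ball (τ n) R = Metric.ball (0 : E) R := by
        ext x; simp
      rw [← (measurePreserving_add_right volume (τ n)).setLIntegral_comp_preimage_emb
        (MeasurableEquiv.addRight (τ n)).measurableEmbedding, hpre]
      refine lintegral_congr_ae (ae_restrict_of_ae ?_)
      filter_upwards [hinv ((n : ℝ) * (2 * R / ‖v‖))] with x hx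
      rw [hx]
    have hdisj : Pairwise (Function.onFun Disjoint fun n => Metric.ball (τ n) R) := by
      intro m n hmn
      refine Metric.ball_disjoint_ball ?_
      rw [dist_eq_norm, hτ, ← sub_smul, norm_smul, ← sub_mul, norm_mul, norm_div, norm_norm,
        mul_assoc, div_mul_cancel₀ _ (norm_ne_zero_iff.2 hv)]
      have h1 : (1 : ℝ) ≤ ‖(m : ℝ) - n‖ := by
        have : (1 : ℤ) ≤ |(m : ℤ) - n| := Int.one_le_abs (sub_ne_zero.2 (by exact_mod_cast hmn))
        rw [Real.norm_eq_abs]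
        exact_mod_cast this
      rw [Real.norm_eq_abs (2 * R), abs_of_pos (by positivity)]
      nlinarith
    have hsum : ∑' _ : ℕ, ∫⁻ x in Metric.ball (0 : E) R, ‖u x‖ₑ ^ 2 ≤ ∫⁻ x, ‖u x‖ₑ ^ 2 := by
      rw [← tsum_congr hset, ← lintegral_iUnion (fun _ => measurableSet_ball) hdisj]
      exact setLIntegral_le_lintegral _ _
    by_contra h0
    rw [ENNReal.tsum_const_eq_top_of_ne_zero h0] at hsum
    exact hfin (top_le_iff.1 hsum)
  have hun : (⋃ n : ℕ, Metric.ball (0 : E) ((n : ℝ) + 1)) = univ := by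
    refine eq_univ_of_forall fun x => mem_iUnion.2 ?_
    obtain ⟨n, hn⟩ := exists_nat_gt ‖x‖
    exact ⟨n, by simp; linarith⟩
  rw [← setLIntegral_univ, ← hun]
  refine le_antisymm ((lintegral_iUnion_le _ _).trans_eq ?_) zero_le
  simp [hball _ (Nat.cast_add_one_pos _)]

end Translation

/-! ### Plancherel's theorem and the symbol of difference quotients. -/

section Fourier

open FourierTransform

variable {V : Type*} [NormedAddCommGroup V] [InnerProductSpace ℝ V] [FiniteDimensional ℝ V]
  [MeasurableSpace V] [BorelSpace V]

lemma continuous_fourier {w : V → ℂ} (hw : Integrable w) : Continuous (𝓕 w) :=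
  VectorFourier.fourierIntegral_continuous Real.continuous_fourierChar continuous_inner hw

/-- Plancherel's theorem on `L¹ ∩ L²`. -/
lemma lintegral_fourier_sq {w : V → ℂ} (hw1 : Integrable w) (hw2 : MemLp w 2) :
    ∫⁻ ξ, ‖𝓕 w ξ‖ₑ ^ 2 = ∫⁻ x, ‖w x‖ₑ ^ 2 := by
  set F : Lp ℂ 2 (volume : Measure V) := 𝓕 hw2.toLp with hF
  -- The integral transform and the `L²` transform agree as distributions: in both cases the
  -- transform can be moved onto the test function.
  have hae : ∀ᵐ ξ, 𝓕 w ξ = F ξ := by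
    refine ae_eq_of_integral_contDiff_smul_eq (continuous_fourier hw1).locallyIntegrable
      ((Lp.memLp F).locallyIntegrable one_le_two) fun φ hφ hφc => ?_
    have hcs : ContDiff ℝ ∞ fun x => (φ x : ℂ) := Complex.ofRealCLM.contDiff.comp hφ
    have hcc : HasCompactSupport fun x => (φ x : ℂ) := hφc.comp_left Complex.ofReal_zero
    set ψ : 𝓢(V, ℂ) := hcc.toSchwartzMap hcs with hψ
    have hψapp : ∀ x, ψ x = (φ x : ℂ) := fun x => rfl
    have h1 : ∫ x, 𝓕 ψ x • w x = ∫ x, ψ x • 𝓕 w x := by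
      have := VectorFourier.integral_fourierIntegral_smul_eq_flip (L := innerₗ V)
        (μ := volume) (ν := volume) Real.continuous_fourierChar continuous_inner ψ.integrable hw1
      rw [flip_innerₗ] at this
      exact this
    have h2 : ∫ x, ψ x • F x = ∫ x, 𝓕 ψ x • w x := by
      have h3 := Lp.toTemperedDistribution_apply F ψ
      rw [hF, ← Lp.fourier_toTemperedDistribution_eq, TemperedDistribution.fourier_apply,
        Lp.toTemperedDistribution_apply] at h3
      rw [hF, ← h3]
      refine integral_congr_ae ?_
      filter_upwards [hw2.coeFn_toLp] with x hx
      rw [hx]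
    rw [← h2] at h1
    simp only [hψapp, smul_eq_mul] at h1
    simp only [Complex.real_smul]
    exact h1.symm
  have h1 : ∫⁻ ξ, ‖𝓕 w ξ‖ₑ ^ 2 = ∫⁻ ξ, ‖F ξ‖ₑ ^ 2 :=
    lintegral_congr_ae (hae.mono fun ξ h => by simp only [h])
  rw [h1, ← Lp_enorm_sq, ← eLpNorm_two_sq, ← Lp.enorm_toLp hw2]
  congr 1
  rw [← ofReal_norm, ← ofReal_norm, hF, Lp.norm_fourier_eq]

lemma lintegral_translate_sub_sq_eq {w : V → ℂ} (hw1 : Integrable w) (hw2 : MemLp w 2) (a : V) :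
    ∫⁻ x, ‖w (x + a) - w x‖ₑ ^ 2 =
      ∫⁻ ξ, ‖(Real.fourierChar (inner ℝ a ξ) : ℂ) - 1‖ₑ ^ 2 * ‖𝓕 w ξ‖ₑ ^ 2 := by
  have hmp : MeasurePreserving (fun x : V => x + a) volume volume :=
    measurePreserving_add_right volume _
  have i1 : Integrable (fun x => w (x + a)) := hw1.comp_add_right a
  have i2 : MemLp (fun x => w (x + a)) 2 := hw2.comp_measurePreserving hmp
  rw [← lintegral_fourier_sq (w := fun x => w (x + a) - w x) (i1.sub hw1) (i2.sub hw2)]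
  refine lintegral_congr fun ξ => ?_
  have h1 : 𝓕 (fun x => w (x + a)) ξ = (Real.fourierChar (inner ℝ a ξ) : ℂ) * 𝓕 w ξ :=
    congrFun (VectorFourier.fourierIntegral_comp_add_right Real.fourierChar volume (innerₗ V) w a) ξ
  have h2 : 𝓕 (fun x => w (x + a) - w x) ξ = 𝓕 (fun x => w (x + a)) ξ - 𝓕 w ξ := by
    simp only [Real.fourier_eq, smul_sub]
    exact integral_sub ((Real.fourierIntegral_convergent_iff ξ).2 i1)
      ((Real.fourierIntegral_convergent_iff ξ).2 hw1)
  rw [h2, h1, ← mul_pow, ← enorm_mul, sub_mul, one_mul]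

/-- With step `1 / (k + 1)`, the Fourier multiplier of the squared difference quotient tends to the
symbol `(2πs)²` of the squared derivative. -/
lemma tendsto_fourierChar_sub_one_div (s : ℝ) :
    Tendsto (fun k : ℕ => ENNReal.ofReal (((k : ℝ) + 1) ^ 2) *
      ‖(Real.fourierChar ((1 / ((k : ℝ) + 1)) * s) : ℂ) - 1‖ₑ ^ 2) atTop
      (𝓝 (ENNReal.ofReal ((2 * Real.pi * s) ^ 2))) := by
  have hd : HasDerivAt (fun t : ℝ => (Real.fourierChar (t * s) : ℂ))
      (2 * Real.pi * s * Complex.I) 0 := by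
    have h := (Real.hasDerivAt_fourierChar (0 * s)).scomp 0 ((hasDerivAt_id (0 : ℝ)).mul_const s)
    refine (h.congr_deriv ?_)
    simp
    ring
  have h1 := hd.tendsto_slope_zero.comp (tendsto_nhdsWithin_iff.2
    ⟨tendsto_one_div_add_atTop_nhds_zero_nat (𝕜 := ℝ), Eventually.of_forall fun k => by
      simp only [mem_compl_iff, mem_singleton_iff]; positivity⟩)
  have h2 := (ENNReal.continuous_ofReal.tendsto _).comp ((h1.norm).pow 2)
  refine (h2.congr fun k => ?_).trans_eq ?_
  · simp only [Function.comp_apply, zero_add, zero_mul, one_div, inv_inv]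
    rw [norm_smul, mul_pow, ENNReal.ofReal_mul (by positivity), Real.norm_eq_abs, sq_abs,
      ENNReal.ofReal_pow (norm_nonneg _), ofReal_norm]
    simp
  · congr 2
    simp [abs_of_pos Real.pi_pos, mul_pow]

end Fourier

/-! ### The bathtub estimate in momentum space. -/

lemma lintegral_ofReal_sub_norm_sq {d : ℕ} (hd : 1 ≤ d) {m : ℝ} (hm : 0 ≤ m) :
    ∫⁻ ξ : Space d, ENNReal.ofReal (m - (2 * Real.pi) ^ 2 * ‖ξ‖ ^ 2) =
      ENNReal.ofReal (√Real.pi ^ d / Real.Gamma ((d : ℝ) / 2 + 1) * ((2 * Real.pi) ^ d)⁻¹ *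
        (m ^ ((d : ℝ) / 2 + 1) / ((d : ℝ) / 2 + 1))) := by
  have : Nonempty (Fin d) := ⟨⟨0, hd⟩⟩
  have hpi := Real.pi_pos
  have h1 : ∀ ξ : Space d, ENNReal.ofReal (m - (2 * Real.pi) ^ 2 * ‖ξ‖ ^ 2) =
      ENNReal.ofReal (max (m - (2 * Real.pi) ^ 2 * ‖ξ‖ ^ 2) 0) := by
    intro ξ; simp
  simp_rw [h1]
  -- Layer cake: for `0 < t ≤ m` the superlevel set is the ball of radius `√(m - t) / (2π)`, which
  -- leaves a multiple of `∫₀ᵐ (m - t)^{d/2} dt`.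
  rw [lintegral_eq_lintegral_meas_lt (f := fun ξ : Space d =>
    max (m - (2 * Real.pi) ^ 2 * ‖ξ‖ ^ 2) 0) _ (Eventually.of_forall fun ξ => le_max_right _ _)
    (by fun_prop)]
  set K := √Real.pi ^ d / Real.Gamma ((d : ℝ) / 2 + 1) with hK
  have hK0 : 0 ≤ K := div_nonneg (by positivity) (Real.Gamma_nonneg_of_nonneg (by positivity))
  have h2 : ∀ t ∈ Ioi (0 : ℝ),
      volume {ξ : Space d | t < max (m - (2 * Real.pi) ^ 2 * ‖ξ‖ ^ 2) 0} =
      (Ioc 0 m).indicator (fun t => ENNReal.ofReal (K * ((2 * Real.pi) ^ d)⁻¹ *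
        (m - t) ^ ((d : ℝ) / 2))) t := by
    intro t ht
    rw [mem_Ioi] at ht
    by_cases htm : t ≤ m
    · rw [indicator_of_mem (show t ∈ Ioc 0 m from ⟨ht, htm⟩)]
      have hset : {ξ : Space d | t < max (m - (2 * Real.pi) ^ 2 * ‖ξ‖ ^ 2) 0} =
          Metric.ball 0 (√(m - t) / (2 * Real.pi)) := by
        ext ξ
        rw [mem_ofPred_eq, mem_ball_zero_iff, lt_div_iff₀ (by positivity),
          Real.lt_sqrt (by positivity), lt_max_iff]
        constructor
        · rintro (h | h)
          · nlinarith
          · linarith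
        · intro h; left; nlinarith
      rw [hset, EuclideanSpace.volume_ball, Fintype.card_fin, ← ENNReal.ofReal_pow (by positivity),
        ← ENNReal.ofReal_mul (by positivity)]
      congr 1
      rw [div_pow, hK, Real.sqrt_eq_rpow, ← Real.rpow_natCast, ← Real.rpow_mul (by linarith)]
      ring_nf
    · rw [indicator_of_notMem (show t ∉ Ioc 0 m from fun h => htm h.2)]
      have : {ξ : Space d | t < max (m - (2 * Real.pi) ^ 2 * ‖ξ‖ ^ 2) 0} = ∅ := by
        refine eq_empty_of_forall_notMem fun ξ h => ?_
        rw [mem_ofPred_eq, lt_max_iff] at h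
        rcases h with h | h
        · have : 0 ≤ (2 * Real.pi) ^ 2 * ‖ξ‖ ^ 2 := by positivity
          linarith
        · linarith
      rw [this, measure_empty]
  rw [setLIntegral_congr_fun measurableSet_Ioi h2, lintegral_indicator measurableSet_Ioc,
    Measure.restrict_restrict measurableSet_Ioc, inter_eq_self_of_subset_left Ioc_subset_Ioi_self]
  have hcont : Continuous fun t : ℝ => K * ((2 * Real.pi) ^ d)⁻¹ * (m - t) ^ ((d : ℝ) / 2) := by
    refine continuous_const.mul ((continuous_const.sub continuous_id).rpow_const fun _ => ?_)
    right; positivity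
  rw [← ofReal_integral_eq_lintegral_ofReal
    ((hcont.integrableOn_Icc (a := 0) (b := m)).mono_set Ioc_subset_Icc_self)
    ((ae_restrict_iff' measurableSet_Ioc).2 (Eventually.of_forall fun t ht =>
      mul_nonneg (by positivity) (Real.rpow_nonneg (by linarith [ht.2]) _))),
    ← intervalIntegral.integral_of_le hm, intervalIntegral.integral_const_mul,
    intervalIntegral.integral_comp_sub_left (fun t => t ^ ((d : ℝ) / 2)), integral_rpow
      (Or.inl (by have : (0 : ℝ) ≤ (d : ℝ) / 2 := by positivity
                  linarith))]
  congr 2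
  rw [sub_self, sub_zero, Real.zero_rpow (by positivity), sub_zero]

section LowerBound

open FourierTransform

variable {d : ℕ}

/-- The semiclassical lower bound on the kinetic energy of a density matrix localized by a fixed
cutoff, with the Laplacian discretized. -/
lemma bathtub_le_liminf (hd : 1 ≤ d) {w : ℕ → Space d → ℂ} (hw1 : ∀ n, Integrable (w n))
    (hw2 : ∀ n, MemLp (w n) 2) {B : ℝ≥0∞} (hBtop : B ≠ ⊤) (hB : ∀ ξ, ∑' n, ‖𝓕 (w n) ξ‖ₑ ^ 2 ≤ B)
    {m : ℝ} (hm : 0 ≤ m) :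
    ENNReal.ofReal m * ∑' n, ∫⁻ x, ‖w n x‖ₑ ^ 2 ≤
      liminf (fun k : ℕ => ∑ j : Fin d, ∑' n, ENNReal.ofReal (((k : ℝ) + 1) ^ 2) *
        ∫⁻ x, ‖w n (x + (1 / ((k : ℝ) + 1)) • EuclideanSpace.single j (1 : ℝ)) - w n x‖ₑ ^ 2) atTop
      + B * ENNReal.ofReal (√Real.pi ^ d / Real.Gamma ((d : ℝ) / 2 + 1) *
        ((2 * Real.pi) ^ d)⁻¹ * (m ^ ((d : ℝ) / 2 + 1) / ((d : ℝ) / 2 + 1))) := by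
  set N : Space d → ℝ≥0∞ := fun ξ => ∑' n, ‖𝓕 (w n) ξ‖ₑ ^ 2 with hN
  have hFm : ∀ n, Measurable fun ξ => ‖𝓕 (w n) ξ‖ₑ ^ 2 := fun n =>
    (continuous_fourier (hw1 n)).measurable.enorm.pow_const 2
  have hNm : Measurable N := Measurable.tsum hFm
  have hNint : ∑' n, ∫⁻ x, ‖w n x‖ₑ ^ 2 = ∫⁻ ξ, N ξ := by
    rw [hN, lintegral_tsum fun n => (hFm n).aemeasurable]
    exact tsum_congr fun n => (lintegral_fourier_sq (hw1 n) (hw2 n)).symm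
  set c : ℕ → Fin d → Space d → ℝ≥0∞ := fun k j ξ =>
    ‖(Real.fourierChar ((1 / ((k : ℝ) + 1)) * ξ j) : ℂ) - 1‖ₑ ^ 2 with hc
  have hcm : ∀ k j, Measurable (c k j) := by
    intro k j
    refine Measurable.pow_const (Measurable.enorm ?_) 2
    have h1 : Continuous fun ξ : Space d => (1 / ((k : ℝ) + 1)) * ξ j := by fun_prop
    exact ((continuous_subtype_val.comp (Real.continuous_fourierChar.comp h1)).sub
      continuous_const).measurable
  set M : ℕ → Space d → ℝ≥0∞ := fun k ξ => ∑ j : Fin d, ENNReal.ofReal (((k : ℝ) + 1) ^ 2) *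
      c k j ξ with hM
  have hMm : ∀ k, Measurable (M k) := fun k =>
    Finset.measurable_sum _ fun j _ => (hcm k j).const_mul _
  have hMNm : ∀ k, Measurable fun ξ => M k ξ * N ξ := fun k => (hMm k).mul hNm
  have hDk : ∀ k : ℕ, ∑ j : Fin d, ∑' n, ENNReal.ofReal (((k : ℝ) + 1) ^ 2) *
        ∫⁻ x, ‖w n (x + (1 / ((k : ℝ) + 1)) • EuclideanSpace.single j (1 : ℝ)) - w n x‖ₑ ^ 2 =
        ∫⁻ ξ, M k ξ * N ξ := by
    intro k
    have h1 : ∀ ξ, M k ξ * N ξ = ∑ j : Fin d, ∑' n, ENNReal.ofReal (((k : ℝ) + 1) ^ 2) *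
        (c k j ξ * ‖𝓕 (w n) ξ‖ₑ ^ 2) := by
      intro ξ
      rw [hM, Finset.sum_mul]
      refine Finset.sum_congr rfl fun j _ => ?_
      rw [hN, mul_assoc, ← ENNReal.tsum_mul_left, ← ENNReal.tsum_mul_left]
    have hcF : ∀ j n, Measurable fun ξ => c k j ξ * ‖𝓕 (w n) ξ‖ₑ ^ 2 := fun j n =>
      (hcm k j).mul (hFm n)
    have hcF' : ∀ j n, Measurable fun ξ => ENNReal.ofReal (((k : ℝ) + 1) ^ 2) *
      (c k j ξ * ‖𝓕 (w n) ξ‖ₑ ^ 2) := fun j n => (hcF j n).const_mul _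
    rw [lintegral_congr h1, lintegral_finsetSum _ fun j _ => Measurable.tsum fun n => hcF' j n]
    refine Finset.sum_congr rfl fun j _ => ?_
    rw [lintegral_tsum fun n => (hcF' j n).aemeasurable]
    refine tsum_congr fun n => ?_
    rw [lintegral_const_mul _ (hcF j n), lintegral_translate_sub_sq_eq (hw1 n) (hw2 n)]
    congr 1
    refine lintegral_congr fun ξ => ?_
    rw [real_inner_smul_left, EuclideanSpace.inner_single_left]
    simp [hc]
  simp_rw [hDk]
  -- Bathtub principle, pointwise: `m ≤ 4π²|ξ|² + (m - 4π²|ξ|²)₊`, and in the second term `N` is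
  -- replaced by its bound `B`. Finiteness of `N ξ` is needed to pass to the limit in the product,
  -- in case the symbol vanishes.
  have hpt : ∀ ξ : Space d, ENNReal.ofReal m * N ξ ≤
      liminf (fun k => M k ξ * N ξ) atTop +
        B * ENNReal.ofReal (m - (2 * Real.pi) ^ 2 * ‖ξ‖ ^ 2) := by
    intro ξ
    have hlim : Tendsto (fun k => M k ξ) atTop
        (𝓝 (ENNReal.ofReal ((2 * Real.pi) ^ 2 * ‖ξ‖ ^ 2))) := by
      have h1 : ENNReal.ofReal ((2 * Real.pi) ^ 2 * ‖ξ‖ ^ 2) =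
          ∑ j : Fin d, ENNReal.ofReal ((2 * Real.pi * ξ j) ^ 2) := by
        rw [← ENNReal.ofReal_sum_of_nonneg fun _ _ => by positivity, EuclideanSpace.norm_sq_eq,
          Finset.mul_sum]
        simp [mul_pow]
      rw [h1]
      exact tendsto_finsetSum _ fun j _ => tendsto_fourierChar_sub_one_div (ξ j)
    have htop : N ξ ≠ ⊤ := ne_top_of_le_ne_top hBtop (hB ξ)
    have h2 : Tendsto (fun k => M k ξ * N ξ) atTop
        (𝓝 (ENNReal.ofReal ((2 * Real.pi) ^ 2 * ‖ξ‖ ^ 2) * N ξ)) :=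
      ENNReal.Tendsto.mul_const hlim (Or.inr htop)
    rw [h2.liminf_eq]
    calc ENNReal.ofReal m * N ξ ≤ (ENNReal.ofReal ((2 * Real.pi) ^ 2 * ‖ξ‖ ^ 2) +
          ENNReal.ofReal (m - (2 * Real.pi) ^ 2 * ‖ξ‖ ^ 2)) * N ξ := by
          gcongr
          refine le_trans (ENNReal.ofReal_le_ofReal ?_) ENNReal.ofReal_add_le
          linarith
      _ ≤ _ := by
          rw [add_mul, mul_comm B]
          gcongr
          exact hB ξ
  calc ENNReal.ofReal m * ∑' n, ∫⁻ x, ‖w n x‖ₑ ^ 2 = ∫⁻ ξ, ENNReal.ofReal m * N ξ := by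
        rw [hNint, lintegral_const_mul _ hNm]
    _ ≤ ∫⁻ ξ, (liminf (fun k => M k ξ * N ξ) atTop +
        B * ENNReal.ofReal (m - (2 * Real.pi) ^ 2 * ‖ξ‖ ^ 2)) := lintegral_mono hpt
    _ = (∫⁻ ξ, liminf (fun k => M k ξ * N ξ) atTop) +
        B * ∫⁻ ξ : Space d, ENNReal.ofReal (m - (2 * Real.pi) ^ 2 * ‖ξ‖ ^ 2) := by
        rw [lintegral_add_left (Measurable.liminf hMNm),
          lintegral_const_mul _ (by fun_prop)]
    _ ≤ _ := by
        rw [lintegral_ofReal_sub_norm_sq hd hm]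
        gcongr
        exact lintegral_liminf_le hMNm

end LowerBound

/-! ### The IMS localization formula for finite differences. -/

lemma sq_le_sinh_sq (y : ℝ) : y ^ 2 ≤ Real.sinh y ^ 2 := by
  rcases le_total 0 y with h | h
  · exact pow_le_pow_left₀ h (Real.self_le_sinh_iff.2 h) 2
  · have h1 := Real.sinh_le_self_iff.2 h
    nlinarith

/-- The discrete form of `ρ |∇ ln ρ|² = 4 |∇√ρ|²`. For `a = e^{4α}` and `b = e^{4β}` it reduces to
`(α - β)² ≤ sinh² (α - β)`. -/
lemma sqrt_mul_log_sub_log_sq_le {a b : ℝ} (ha : 0 < a) (hb : 0 < b) :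
    √(a * b) * (Real.log a - Real.log b) ^ 2 ≤ 4 * (√a - √b) ^ 2 := by
  obtain ⟨α, rfl⟩ : ∃ α, a = Real.exp (4 * α) := ⟨Real.log a / 4, by
    rw [mul_div_cancel₀ _ four_ne_zero, Real.exp_log ha]⟩
  obtain ⟨β, rfl⟩ : ∃ β, b = Real.exp (4 * β) := ⟨Real.log b / 4, by
    rw [mul_div_cancel₀ _ four_ne_zero, Real.exp_log hb]⟩
  have hs : ∀ t, √(Real.exp (4 * t)) = Real.exp (2 * t) := by
    intro t
    rw [Real.sqrt_eq_iff_mul_self_eq (Real.exp_nonneg _) (Real.exp_nonneg _), ← Real.exp_add]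
    ring_nf
  have h1 : Real.exp (2 * α) - Real.exp (2 * β) =
      2 * Real.exp (α + β) * Real.sinh (α - β) := by
    have e1 : Real.exp (2 * α) = Real.exp (α + β) * Real.exp (α - β) := by
      rw [← Real.exp_add]; ring_nf
    have e2 : Real.exp (2 * β) = Real.exp (α + β) * Real.exp (-(α - β)) := by
      rw [← Real.exp_add]; ring_nf
    rw [Real.sinh_eq, e1, e2]
    ring
  rw [Real.sqrt_mul (Real.exp_nonneg _), hs, hs, h1, Real.log_exp, Real.log_exp, ← Real.exp_add]
  have h2 : Real.exp (2 * α + 2 * β) = Real.exp (α + β) ^ 2 := by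
    rw [sq, ← Real.exp_add]; ring_nf
  rw [h2]
  have h3 := mul_le_mul_of_nonneg_left (sq_le_sinh_sq (α - β)) (sq_nonneg (Real.exp (α + β)))
  nlinarith

lemma memLp_two_of_lintegral {α F : Type*} [MeasurableSpace α] [NormedAddCommGroup F]
    {μ : Measure α} {f : α → F} (hf : AEStronglyMeasurable f μ)
    (h : ∫⁻ x, ‖f x‖ₑ ^ 2 ∂μ ≠ ⊤) : MemLp f 2 μ := by
  refine ⟨hf, ?_⟩
  rw [← eLpNorm_two_sq] at h
  by_contra h'
  rw [not_lt, top_le_iff] at h'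
  rw [h'] at h
  exact h (by simp)

lemma enorm_sq_eq_ofReal {F : Type*} [NormedAddCommGroup F] (x : F) :
    ‖x‖ₑ ^ 2 = ENNReal.ofReal (‖x‖ ^ 2) := by
  rw [ENNReal.ofReal_pow (norm_nonneg _), ofReal_norm]

lemma lintegral_enorm_sq_eq_ofReal {α F : Type*} [MeasurableSpace α] [NormedAddCommGroup F]
    {μ : Measure α} {f : α → F} (hf : MemLp f 2 μ) :
    ∫⁻ x, ‖f x‖ₑ ^ 2 ∂μ = ENNReal.ofReal (∫ x, ‖f x‖ ^ 2 ∂μ) := by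
  rw [ofReal_integral_eq_lintegral_ofReal (hf.integrable_norm_pow two_ne_zero)
    (Eventually.of_forall fun _ => by positivity)]
  exact lintegral_congr fun x => enorm_sq_eq_ofReal _

section IMS

variable {f : ℝ → ℝ} {R : ℝ≥0∞}

/-- Expand the square and write `2ff'` as `f² + f'² - (f' - f)²` for the two shifted profiles `f`,
`f'`. As both have norm one, the integral equals `|z' - z|² + Re(z' z̄) ∫ (f' - f)²`, and `Re(z' z̄)
≤ |z| |z'|`. -/
lemma lintegral_localized_sub_le (hf : Measurable f) (hf1 : ∫⁻ r, ‖f r‖ₑ ^ 2 = 1)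
    (z z' : ℂ) (l l' : ℝ) :
    ∫⁻ r, ‖(f (r - l') : ℂ) * z' - (f (r - l) : ℂ) * z‖ₑ ^ 2 ≤
      ‖z' - z‖ₑ ^ 2 + (∫⁻ r, ‖f (r + (l - l')) - f r‖ₑ ^ 2) * (‖z‖ₑ * ‖z'‖ₑ) := by
  have hmem : MemLp f 2 := memLp_two_of_lintegral hf.aestronglyMeasurable (by simp [hf1])
  have hp : ∀ s, MemLp (fun r => f (r - s)) 2 := fun s =>
    hmem.comp_measurePreserving (measurePreserving_sub_right volume s)
  have hsq : ∀ s, ∫ r, f (r - s) ^ 2 = 1 := by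
    intro s
    rw [integral_sub_right_eq_self (fun r => f r ^ 2) s]
    have h := lintegral_enorm_sq_eq_ofReal hmem
    rw [hf1, eq_comm, ENNReal.ofReal_eq_one] at h
    simpa using h
  have hF : ∫⁻ r, ‖f (r + (l - l')) - f r‖ₑ ^ 2 =
      ENNReal.ofReal (∫ r, (f (r - l') - f (r - l)) ^ 2) := by
    have h := lintegral_enorm_sq_eq_ofReal ((hp l').sub (hp l))
    simp only [Pi.sub_apply, Real.norm_eq_abs, sq_abs] at h
    rw [← h, ← lintegral_add_right_eq_self (fun r => ‖f (r - l') - f (r - l)‖ₑ ^ 2) l]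
    refine lintegral_congr fun r => ?_
    rw [add_sub_cancel_right, add_sub_assoc]
  have hc : ∀ s (y : ℂ), MemLp (fun r => (f (r - s) : ℂ) * y) 2 := fun s y => by
    have := ((hp s).ofReal (K := ℂ)).mul_const y
    exact this
  have hint := lintegral_enorm_sq_eq_ofReal ((hc l' z').sub (hc l z))
  simp only [Pi.sub_apply] at hint
  set P := ∫ r, (f (r - l') - f (r - l)) ^ 2 with hP
  have hP0 : 0 ≤ P := integral_nonneg fun _ => sq_nonneg _
  have i1 : Integrable (fun r => f (r - l') ^ 2) := (hp l').integrable_sq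
  have i2 : Integrable (fun r => f (r - l) ^ 2) := (hp l).integrable_sq
  have i3 : Integrable (fun r => (f (r - l') - f (r - l)) ^ 2) := ((hp l').sub (hp l)).integrable_sq
  have heq : ∫ r, ‖(f (r - l') : ℂ) * z' - (f (r - l) : ℂ) * z‖ ^ 2 =
      ‖z' - z‖ ^ 2 + P * (z'.re * z.re + z'.im * z.im) := by
    have hpt : ∀ r, ‖(f (r - l') : ℂ) * z' - (f (r - l) : ℂ) * z‖ ^ 2 =
        (f (r - l') ^ 2 * (‖z'‖ ^ 2 - (z'.re * z.re + z'.im * z.im)) +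
        f (r - l) ^ 2 * (‖z‖ ^ 2 - (z'.re * z.re + z'.im * z.im))) +
        (f (r - l') - f (r - l)) ^ 2 * (z'.re * z.re + z'.im * z.im) := by
      intro r
      simp only [Complex.sq_norm, Complex.normSq_apply]
      simp
      ring
    simp_rw [hpt]
    have i12 : Integrable fun r => f (r - l') ^ 2 * (‖z'‖ ^ 2 - (z'.re * z.re + z'.im * z.im)) +
        f (r - l) ^ 2 * (‖z‖ ^ 2 - (z'.re * z.re + z'.im * z.im)) :=
      (i1.mul_const _).add (i2.mul_const _)
    rw [integral_add i12 (i3.mul_const _), integral_add (i1.mul_const _) (i2.mul_const _), integral_mul_const, integral_mul_const,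
      integral_mul_const, hsq, hsq, ← hP]
    simp only [Complex.sq_norm, Complex.normSq_apply]
    simp
    ring
  have hcs : z'.re * z.re + z'.im * z.im ≤ ‖z‖ * ‖z'‖ := by
    have h1 := Complex.re_le_norm (z' * (starRingEnd ℂ) z)
    rw [norm_mul, Complex.norm_conj] at h1
    simp at h1
    linarith
  rw [hint, heq, hF, enorm_sq_eq_ofReal, ← ofReal_norm z, ← ofReal_norm z',
    ← ENNReal.ofReal_mul (norm_nonneg _), ← ENNReal.ofReal_mul hP0,
    ← ENNReal.ofReal_add (by positivity) (by positivity)]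
  refine ENNReal.ofReal_le_ofReal ?_
  gcongr

/-- Cauchy–Schwarz, through Young's inequality `xy ≤ θx² + κy²` with `4θκ = 1` and the weights that
give equality after summation. -/
lemma tsum_enorm_mul_enorm_le {z z' : ℕ → ℂ} {a b : ℝ} (ha : 0 < a) (hb : 0 < b)
    (hz : ∑' n, ‖z n‖ₑ ^ 2 = ENNReal.ofReal a) (hz' : ∑' n, ‖z' n‖ₑ ^ 2 = ENNReal.ofReal b) :
    ∑' n, ‖z n‖ₑ * ‖z' n‖ₑ ≤ ENNReal.ofReal (√(a * b)) := by
  have hsa := Real.sqrt_pos.2 ha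
  have hsb := Real.sqrt_pos.2 hb
  set θ := √b / (2 * √a) with hθ
  set κ := √a / (2 * √b) with hκ
  have hθ0 : 0 < θ := by positivity
  have hκ0 : 0 < κ := by positivity
  have hθκ : θ * κ = 1 / 4 := by rw [hθ, hκ]; field_simp; norm_num
  have hpt : ∀ n, ‖z n‖ₑ * ‖z' n‖ₑ ≤
      ENNReal.ofReal θ * ‖z n‖ₑ ^ 2 + ENNReal.ofReal κ * ‖z' n‖ₑ ^ 2 := by
    intro n
    rw [enorm_sq_eq_ofReal, enorm_sq_eq_ofReal, ← ofReal_norm (z n), ← ofReal_norm (z' n),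
      ← ENNReal.ofReal_mul (norm_nonneg _), ← ENNReal.ofReal_mul hθ0.le,
      ← ENNReal.ofReal_mul hκ0.le, ← ENNReal.ofReal_add (by positivity) (by positivity)]
    refine ENNReal.ofReal_le_ofReal ?_
    have h1 := mul_nonneg hκ0.le (sq_nonneg (2 * θ * ‖z n‖ - ‖z' n‖))
    have h2 : κ * (2 * θ * ‖z n‖ - ‖z' n‖) ^ 2 = θ * ‖z n‖ ^ 2 * (4 * (θ * κ)) -
        ‖z n‖ * ‖z' n‖ * (4 * (θ * κ)) + κ * ‖z' n‖ ^ 2 := by ring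
    rw [h2, hθκ] at h1
    linarith
  refine (ENNReal.tsum_le_tsum hpt).trans ?_
  rw [ENNReal.tsum_add, ENNReal.tsum_mul_left, ENNReal.tsum_mul_left, hz, hz',
    ← ENNReal.ofReal_mul hθ0.le, ← ENNReal.ofReal_mul hκ0.le,
    ← ENNReal.ofReal_add (by positivity) (by positivity)]
  refine ENNReal.ofReal_le_ofReal (le_of_eq ?_)
  have e1 : θ * a = √b / (2 * √a) * (√a * √a) := by rw [Real.mul_self_sqrt ha.le]
  have e2 : κ * b = √a / (2 * √b) * (√b * √b) := by rw [Real.mul_self_sqrt hb.le]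
  rw [Real.sqrt_mul ha.le, e1, e2]
  field_simp
  ring

/-- The localization formula, with finite differences in place of derivatives. -/
lemma tsum_lintegral_localized_sub_le (hf : Measurable f) (hf1 : ∫⁻ r, ‖f r‖ₑ ^ 2 = 1)
    (hR : ∀ a : ℝ, ∫⁻ r, ‖f (r + a) - f r‖ₑ ^ 2 ≤ ENNReal.ofReal (a ^ 2) * R)
    {z z' : ℕ → ℂ} {a b δ l l' : ℝ} (ha : 0 ≤ a) (hb : 0 ≤ b) (hδ : 0 ≤ δ)
    (hz : ∑' n, ‖z n‖ₑ ^ 2 = ENNReal.ofReal a) (hz' : ∑' n, ‖z' n‖ₑ ^ 2 = ENNReal.ofReal b)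
    (hl : 0 < a → 0 < b → (l - l') ^ 2 ≤ δ * (Real.log a - Real.log b) ^ 2) :
    ∑' n, ∫⁻ r, ‖((if 0 < b then f (r - l') else 0 : ℝ) : ℂ) * z' n -
        ((if 0 < a then f (r - l) else 0 : ℝ) : ℂ) * z n‖ₑ ^ 2 ≤
      ∑' n, ‖z' n - z n‖ₑ ^ 2 + ENNReal.ofReal (4 * δ) * R * ‖√b - √a‖ₑ ^ 2 := by
  have hconst : ∀ (s : ℝ) (y : ℂ), ∫⁻ r, ‖(f (r - s) : ℂ) * y‖ₑ ^ 2 = ‖y‖ₑ ^ 2 := by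
    intro s y
    simp_rw [enorm_mul, mul_pow]
    rw [lintegral_mul_const _ (by fun_prop)]
    have : ∀ r, ‖(f (r - s) : ℂ)‖ₑ ^ 2 = ‖f (r - s)‖ₑ ^ 2 := by
      intro r; rw [enorm_sq_eq_ofReal, enorm_sq_eq_ofReal, Complex.norm_real]
    simp_rw [this]
    rw [lintegral_sub_right_eq_self (fun r => ‖f r‖ₑ ^ 2), hf1, one_mul]
  have hzero : ∀ y : ℕ → ℂ, ∑' n, ‖y n‖ₑ ^ 2 = ENNReal.ofReal 0 → ∀ n, y n = 0 := by
    intro y hy n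
    rw [ENNReal.ofReal_zero, ENNReal.tsum_eq_zero] at hy
    simpa using hy n
  -- Where one density vanishes, all the components vanish there too. The cutoff then acts on one
  -- side only and integrates to one, so its gradient term is not needed.
  rcases ha.eq_or_lt with rfl | ha
  · have h0 := hzero z hz
    rcases hb.eq_or_lt with rfl | hb
    · simp [hzero z' hz', h0]
    · simp only [h0, hb, if_true, mul_zero, sub_zero, hconst]
      exact le_self_add
  · rcases hb.eq_or_lt with rfl | hb
    · have h0 := hzero z' hz'
      simp only [h0, ha, if_true, mul_zero, zero_sub, enorm_neg, hconst]
      exact le_self_add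
    · simp only [ha, hb, if_true]
      have hF : (∫⁻ r, ‖f (r + (l - l')) - f r‖ₑ ^ 2) ≤
          ENNReal.ofReal (δ * (Real.log a - Real.log b) ^ 2) * R :=
        (hR _).trans (by gcongr; exact hl ha hb)
      calc _ ≤ ∑' n, (‖z' n - z n‖ₑ ^ 2 +
            (∫⁻ r, ‖f (r + (l - l')) - f r‖ₑ ^ 2) * (‖z n‖ₑ * ‖z' n‖ₑ)) :=
            ENNReal.tsum_le_tsum fun n => lintegral_localized_sub_le hf hf1 _ _ _ _
        _ = ∑' n, ‖z' n - z n‖ₑ ^ 2 +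
            (∫⁻ r, ‖f (r + (l - l')) - f r‖ₑ ^ 2) * ∑' n, ‖z n‖ₑ * ‖z' n‖ₑ := by
            rw [ENNReal.tsum_add, ENNReal.tsum_mul_left]
        _ ≤ ∑' n, ‖z' n - z n‖ₑ ^ 2 +
            ENNReal.ofReal (δ * (Real.log a - Real.log b) ^ 2) * R *
              ENNReal.ofReal (√(a * b)) := by
            gcongr
            exact tsum_enorm_mul_enorm_le ha hb hz hz'
        _ ≤ _ := by
            rw [mul_right_comm, ← ENNReal.ofReal_mul (by positivity), mul_right_comm (ENNReal.ofReal
              (4 * δ)), enorm_sq_eq_ofReal, ← ENNReal.ofReal_mul (by positivity), Real.norm_eq_abs,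
              sq_abs]
            gcongr _ + ENNReal.ofReal ?_ * _
            have := mul_le_mul_of_nonneg_left (sqrt_mul_log_sub_log_sq_le ha hb) hδ
            linarith [sub_sq_comm (√a) (√b)]

end IMS

/-! ### Kinetic energy of the localized density matrices. -/

section LocalizedBound

open FourierTransform

variable {d : ℕ} {f : ℝ → ℝ} {R M : ℝ≥0∞} {v : ℕ → Space d → ℂ} {ρ : Space d → ℝ}

lemma lintegral_exp_mul_shift (f : ℝ → ℝ) (p l : ℝ) :
    ∫⁻ r, ENNReal.ofReal (Real.exp (p * r)) * ‖f (r - l)‖ₑ ^ 2 =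
      ENNReal.ofReal (Real.exp (p * l)) *
        ∫⁻ r, ENNReal.ofReal (Real.exp (p * r)) * ‖f r‖ₑ ^ 2 := by
  rw [← lintegral_add_right_eq_self _ l, ← lintegral_const_mul' _ _ ENNReal.ofReal_ne_top]
  refine lintegral_congr fun r => ?_
  rw [add_sub_cancel_right, ← mul_assoc, ← ENNReal.ofReal_mul (Real.exp_nonneg _), ← Real.exp_add]
  ring_nf

/-- The cutoff `f (r - log (min ρ K) / d)`, supported on `{ρ > 0}`. -/
def densityCutoff (f : ℝ → ℝ) (ρ : Space d → ℝ) (K r : ℝ) (x : Space d) : ℝ :=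
  if 0 < ρ x then f (r - Real.log (min (ρ x) K) / d) else 0

lemma measurable_densityCutoff (hf : Measurable f) (hρm : Measurable ρ) (K : ℝ) :
    Measurable fun p : ℝ × Space d => densityCutoff f ρ K p.1 p.2 := by
  unfold densityCutoff
  refine Measurable.ite (measurableSet_lt measurable_const (hρm.comp measurable_snd)) ?_
    measurable_const
  refine hf.comp (measurable_fst.sub (Measurable.div_const (Real.measurable_log.comp ?_) _))
  exact (hρm.comp measurable_snd).min measurable_const

/-- Shifting `r` by `ln (min ρ K) / d` produces the power `p / d`. At points with `ρ = 0` both sides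
vanish; this is where `p / d ≠ 0` enters, because `0 ^ 0 = 1`. -/
lemma lintegral_exp_mul_densityCutoff (f : ℝ → ℝ) {K : ℝ} (hK : 0 < K)
    {p : ℝ} (hp : p / d ≠ 0) {x : Space d} (hx : 0 ≤ ρ x) :
    ∫⁻ r, ENNReal.ofReal (Real.exp (p * r)) * ‖densityCutoff f ρ K r x‖ₑ ^ 2 =
      ENNReal.ofReal (min (ρ x) K ^ (p / d)) *
        ∫⁻ r, ENNReal.ofReal (Real.exp (p * r)) * ‖f r‖ₑ ^ 2 := by
  unfold densityCutoff
  rcases hx.eq_or_lt with h0 | h0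
  · simp [← h0, min_eq_left hK.le, Real.zero_rpow hp]
  · simp only [h0, if_true]
    rw [lintegral_exp_mul_shift, Real.rpow_def_of_pos (lt_min h0 hK)]
    congr 3
    ring

lemma log_min_sub_log_min_sq_le {a b K : ℝ} (ha : 0 < a) (hb : 0 < b) (hK : 0 < K) :
    (Real.log (min a K) - Real.log (min b K)) ^ 2 ≤ (Real.log a - Real.log b) ^ 2 := by
  have hmin : ∀ c : ℝ, 0 < c → Real.log (min c K) = min (Real.log c) (Real.log K) := fun c hc =>
    Real.strictMonoOn_log.monotoneOn.map_min hc hK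
  rw [hmin a ha, hmin b hb]
  exact sq_le_sq.2 (abs_min_sub_min_le_max _ _ _ _ |>.trans (by simp))

/-- The momentum distribution of the localized operator at `ξ` is its expectation in a plane wave.
The plane wave times `χ` is an `L²` function of norm `‖χ‖`, to which the Bessel bound applies. -/
lemma tsum_enorm_fourier_sq_le
    (hbessel : ∀ φ : Space d → ℂ, MemLp φ 2 →
      ∑' n, ‖∫ x, φ x * v n x‖ₑ ^ 2 ≤ ∫⁻ x, ‖φ x‖ₑ ^ 2)
    {χ : Space d → ℝ} (hχ : MemLp χ 2) (ξ : Space d) :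
    ∑' n, ‖𝓕 (fun x => (χ x : ℂ) * v n x) ξ‖ₑ ^ 2 ≤ ∫⁻ x, ‖χ x‖ₑ ^ 2 := by
  set φ : Space d → ℂ := fun x => (Real.fourierChar (-inner ℝ x ξ) : ℂ) * (χ x : ℂ) with hφ
  have hnorm : ∀ x, ‖φ x‖ = ‖χ x‖ := by
    intro x
    rw [hφ, norm_mul, Circle.norm_coe, one_mul, Complex.norm_real]
  have hc : Continuous fun x : Space d => (Real.fourierChar (-inner ℝ x ξ) : ℂ) :=
    continuous_subtype_val.comp (Real.continuous_fourierChar.comp (by fun_prop))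
  have hmem : MemLp φ 2 := by
    refine (hχ.norm).of_le (hc.aestronglyMeasurable.mul
      (Complex.continuous_ofReal.comp_aestronglyMeasurable hχ.1))
      (Eventually.of_forall fun x => by rw [hnorm, norm_norm])
  have h1 : ∀ n, 𝓕 (fun x => (χ x : ℂ) * v n x) ξ = ∫ x, φ x * v n x := by
    intro n
    rw [Real.fourier_eq]
    refine integral_congr_ae (Eventually.of_forall fun x => ?_)
    simp only [hφ, Circle.smul_def, smul_eq_mul, mul_assoc]
  simp_rw [h1]
  refine (hbessel φ hmem).trans_eq (lintegral_congr fun x => ?_)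
  rw [enorm_sq_eq_ofReal, enorm_sq_eq_ofReal, hnorm]

/-- The phase space constant `(2π)⁻ᵈ |B₁| / (1 + d/2)`. -/
def phaseSpaceConst (d : ℕ) : ℝ :=
  √Real.pi ^ d / Real.Gamma ((d : ℝ) / 2 + 1) * ((2 * Real.pi) ^ d)⁻¹ / ((d : ℝ) / 2 + 1)

/-- The pointwise localization formula between `x` and `x + y`, integrated over `x`. The cutoffs are
shifted by logarithms divided by `d`, so `δ = 1 / d²`; truncation at `K` only decreases the
difference of logarithms. -/
lemma lintegral_translate_densityCutoff_le (hd : 1 ≤ d)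
    (hf : Measurable f) (hf1 : ∫⁻ r, ‖f r‖ₑ ^ 2 = 1)
    (hR : ∀ a : ℝ, ∫⁻ r, ‖f (r + a) - f r‖ₑ ^ 2 ≤ ENNReal.ofReal (a ^ 2) * R)
    (hv : ∀ n, Measurable (v n)) (hρm : Measurable ρ) (hρ0 : ∀ x, 0 ≤ ρ x)
    (hvρ : ∀ x, ∑' n, ‖v n x‖ₑ ^ 2 = ENNReal.ofReal (ρ x)) {K : ℝ} (hK : 0 < K) (y : Space d) :
    ∫⁻ r, ∑' n, ∫⁻ x, ‖(densityCutoff f ρ K r (x + y) : ℂ) * v n (x + y) -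
        (densityCutoff f ρ K r x : ℂ) * v n x‖ₑ ^ 2 ≤
      ∑' n, (∫⁻ x, ‖v n (x + y) - v n x‖ₑ ^ 2) +
        ENNReal.ofReal (4 / (d : ℝ) ^ 2) * R * ∫⁻ x, ‖√(ρ (x + y)) - √(ρ x)‖ₑ ^ 2 := by
  have hχ := measurable_densityCutoff hf hρm K
  have hwm : ∀ n, Measurable fun p : ℝ × Space d =>
      ‖(densityCutoff f ρ K p.1 (p.2 + y) : ℂ) * v n (p.2 + y) -
        (densityCutoff f ρ K p.1 p.2 : ℂ) * v n p.2‖ₑ ^ 2 := by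
    intro n
    have h1 : Measurable fun p : ℝ × Space d => densityCutoff f ρ K p.1 (p.2 + y) :=
      hχ.comp (measurable_fst.prodMk (measurable_snd.add_const y))
    have h2 : Measurable fun p : ℝ × Space d => v n (p.2 + y) :=
      (hv n).comp (measurable_snd.add_const y)
    have h3 : Measurable fun p : ℝ × Space d => v n p.2 := (hv n).comp measurable_snd
    exact (((Complex.measurable_ofReal.comp h1).mul h2).sub
      ((Complex.measurable_ofReal.comp hχ).mul h3)).enorm.pow_const 2
  have hvm : ∀ n, Measurable fun x => ‖v n (x + y) - v n x‖ₑ ^ 2 := fun n =>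
    (((hv n).comp (measurable_id.add_const y)).sub (hv n)).enorm.pow_const 2
  have hsm : Measurable fun x => ‖√(ρ (x + y)) - √(ρ x)‖ₑ ^ 2 :=
    (((hρm.comp (measurable_id.add_const y)).sqrt).sub hρm.sqrt).enorm.pow_const 2
  rw [lintegral_tsum fun n => (hwm n).lintegral_prod_right'.aemeasurable]
  have hswap : ∀ n, ∫⁻ r, ∫⁻ x, ‖(densityCutoff f ρ K r (x + y) : ℂ) * v n (x + y) -
        (densityCutoff f ρ K r x : ℂ) * v n x‖ₑ ^ 2 =
      ∫⁻ x, ∫⁻ r, ‖(densityCutoff f ρ K r (x + y) : ℂ) * v n (x + y) -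
        (densityCutoff f ρ K r x : ℂ) * v n x‖ₑ ^ 2 := fun n =>
    lintegral_lintegral_swap (hwm n).aemeasurable
  simp_rw [hswap]
  rw [← lintegral_tsum fun n => (hwm n).lintegral_prod_left'.aemeasurable,
    ← lintegral_tsum fun n => (hvm n).aemeasurable, ← lintegral_const_mul _ hsm,
    ← lintegral_add_left (Measurable.tsum hvm)]
  refine lintegral_mono fun x => ?_
  have hd0 : (0 : ℝ) < d := by exact_mod_cast hd
  have h := tsum_lintegral_localized_sub_le hf hf1 hR (z := fun n => v n x)
    (z' := fun n => v n (x + y)) (δ := 1 / (d : ℝ) ^ 2) (l := Real.log (min (ρ x) K) / d)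
    (l' := Real.log (min (ρ (x + y)) K) / d) (hρ0 x) (hρ0 (x + y)) (by positivity) (hvρ x)
    (hvρ (x + y)) (fun ha hb => by
      rw [← sub_div, div_pow, div_eq_mul_one_div, mul_comm]
      exact mul_le_mul_of_nonneg_left (log_min_sub_log_min_sq_le ha hb hK) (by positivity))
  rw [mul_one_div] at h
  exact h

/-- The upper and lower bounds on the localized energies, combined for an arbitrary `c`. Finiteness
of the truncated integral is part of the conclusion, since the last term is later cancelled from
both sides. -/
theorem localized_kinetic_bound (hd : 1 ≤ d)
    (hf : Measurable f) (hf1 : ∫⁻ r, ‖f r‖ₑ ^ 2 = 1)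
    (hf2 : ∫⁻ r, ENNReal.ofReal (Real.exp (2 * r)) * ‖f r‖ₑ ^ 2 = 1)
    (hM : ∫⁻ r, ENNReal.ofReal (Real.exp (((d : ℝ) + 2) * r)) * ‖f r‖ₑ ^ 2 = M) (hMtop : M ≠ ⊤)
    (hR : ∀ a : ℝ, ∫⁻ r, ‖f (r + a) - f r‖ₑ ^ 2 ≤ ENNReal.ofReal (a ^ 2) * R)
    (hv : ∀ n, Measurable (v n)) (hρm : Measurable ρ) (hρ0 : ∀ x, 0 ≤ ρ x)
    (hvρ : ∀ x, ∑' n, ‖v n x‖ₑ ^ 2 = ENNReal.ofReal (ρ x))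
    (hρint : ∫⁻ x, ENNReal.ofReal (ρ x) ≠ ⊤)
    (hbessel : ∀ φ : Space d → ℂ, MemLp φ 2 →
      ∑' n, ‖∫ x, φ x * v n x‖ₑ ^ 2 ≤ ∫⁻ x, ‖φ x‖ₑ ^ 2)
    {T G : Fin d → ℝ≥0∞}
    (hT : ∀ (j : Fin d) (t : ℝ), ∑' n, (∫⁻ x, ‖v n (x + t • EuclideanSpace.single j (1 : ℝ)) -
      v n x‖ₑ ^ 2) ≤ ENNReal.ofReal (t ^ 2) * T j)
    (hG : ∀ (j : Fin d) (t : ℝ), ∫⁻ x, ‖√(ρ (x + t • EuclideanSpace.single j (1 : ℝ))) -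
      √(ρ x)‖ₑ ^ 2 ≤ ENNReal.ofReal (t ^ 2) * G j)
    {c : ℝ} (hc : 0 ≤ c) {K : ℝ} (hK : 0 < K) :
    ∫⁻ x, ENNReal.ofReal (min (ρ x) K ^ (1 + 2 / (d : ℝ))) ≠ ⊤ ∧
    ENNReal.ofReal c * ∫⁻ x, ENNReal.ofReal (min (ρ x) K ^ (1 + 2 / (d : ℝ))) ≤
      ∑ j, (T j + ENNReal.ofReal (4 / (d : ℝ) ^ 2) * R * G j) +
        ENNReal.ofReal (phaseSpaceConst d * c ^ ((d : ℝ) / 2 + 1)) *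
          (M * ∫⁻ x, ENNReal.ofReal (min (ρ x) K ^ (1 + 2 / (d : ℝ)))) := by
  have hd0 : (0 : ℝ) < d := by exact_mod_cast hd
  have hχ := measurable_densityCutoff hf hρm K
  set χ := densityCutoff f ρ K with hχdef
  have hχr : ∀ r, Measurable (χ r) := fun r => hχ.comp measurable_prodMk_left
  have hχe : Measurable fun p : ℝ × Space d => ‖χ p.1 p.2‖ₑ ^ 2 := hχ.enorm.pow_const 2
  set I := ∫⁻ x, ENNReal.ofReal (min (ρ x) K ^ (1 + 2 / (d : ℝ))) with hI
  have hσpow : ∀ x, min (ρ x) K ^ (1 + 2 / (d : ℝ)) = min (ρ x) K * min (ρ x) K ^ (2 / (d : ℝ)) := by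
    intro x
    have h0 : 0 ≤ min (ρ x) K := le_min (hρ0 x) hK.le
    rcases h0.eq_or_lt with h | h
    · rw [← h, zero_mul, Real.zero_rpow (by positivity)]
    · rw [Real.rpow_add h, Real.rpow_one]
  have hItop : I ≠ ⊤ := by
    refine ne_top_of_le_ne_top (ENNReal.mul_ne_top (ENNReal.ofReal_ne_top
      (r := K ^ (2 / (d : ℝ)))) hρint) ?_
    rw [← lintegral_const_mul' _ _ ENNReal.ofReal_ne_top]
    refine lintegral_mono fun x => ?_
    rw [hσpow, ← ENNReal.ofReal_mul (by positivity), mul_comm]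
    have h0 : 0 ≤ min (ρ x) K := le_min (hρ0 x) hK.le
    refine ENNReal.ofReal_le_ofReal (mul_le_mul (Real.rpow_le_rpow h0 (min_le_right _ _)
      (by positivity)) (min_le_left _ _) h0 (by positivity))
  refine ⟨hItop, ?_⟩
  set B : ℝ → ℝ≥0∞ := fun r => ∫⁻ x, ‖χ r x‖ₑ ^ 2 with hB
  have hBm : Measurable B := hχe.lintegral_prod_right'
  have hexpm : ∀ p : ℝ, Measurable fun r => ENNReal.ofReal (Real.exp (p * r)) := fun p => by
    fun_prop
  have hBint : ∫⁻ r, ENNReal.ofReal (Real.exp (((d : ℝ) + 2) * r)) * B r = M * I := by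
    simp_rw [hB, ← lintegral_const_mul' _ _ ENNReal.ofReal_ne_top]
    rw [lintegral_lintegral_swap (((hexpm _).comp measurable_fst).mul hχe).aemeasurable, hI,
      ← lintegral_const_mul' _ _ hMtop]
    refine lintegral_congr fun x => ?_
    rw [lintegral_exp_mul_densityCutoff f hK (by positivity) (hρ0 x), hM, mul_comm, add_div,
      div_self hd0.ne']
  -- The weighted integral of `B` equals `M * I`, which is finite; so almost every cutoff is in `L²`
  -- and the bathtub estimate applies to it.
  have hBae : ∀ᵐ r, B r ≠ ⊤ := by
    have h1 := ae_lt_top ((hexpm ((d : ℝ) + 2)).mul hBm) (by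
      rw [show (∫⁻ r, ((fun r => ENNReal.ofReal (Real.exp (((d : ℝ) + 2) * r))) * B) r) = M * I
        from hBint]
      exact ENNReal.mul_ne_top hMtop hItop)
    filter_upwards [h1] with r hr htop
    rw [Pi.mul_apply, htop, ENNReal.mul_top (by simpa using Real.exp_pos _)] at hr
    exact lt_irrefl _ hr
  have hvint : ∀ n, ∫⁻ x, ‖v n x‖ₑ ^ 2 ≠ ⊤ := fun n =>
    ne_top_of_le_ne_top hρint (lintegral_mono fun x => (hvρ x) ▸ ENNReal.le_tsum n)
  have hvL2 : ∀ n, MemLp (v n) 2 := fun n =>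
    memLp_two_of_lintegral (hv n).aestronglyMeasurable (hvint n)
  set w : ℝ → ℕ → Space d → ℂ := fun r n x => (χ r x : ℂ) * v n x with hw
  have hwm : ∀ n, Measurable fun p : ℝ × Space d => w p.1 n p.2 := fun n =>
    (Complex.measurable_ofReal.comp hχ).mul ((hv n).comp measurable_snd)
  have hwx : ∀ r n, Measurable (w r n) := fun r n =>
    (Complex.measurable_ofReal.comp (hχr r)).mul (hv n)
  have hwsq : ∀ r n x, ‖w r n x‖ₑ ^ 2 = ‖χ r x‖ₑ ^ 2 * ‖v n x‖ₑ ^ 2 := by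
    intro r n x
    rw [hw, enorm_mul, mul_pow]
    congr 1
    rw [enorm_sq_eq_ofReal, enorm_sq_eq_ofReal, Complex.norm_real]
  have hwe : ∀ n, Measurable fun p : ℝ × Space d => ‖w p.1 n p.2‖ₑ ^ 2 := fun n =>
    (hwm n).enorm.pow_const 2
  have hχ1 : ∀ x, ∫⁻ r, ‖χ r x‖ₑ ^ 2 ≤ 1 := by
    intro x
    by_cases h : 0 < ρ x
    · simp only [hχdef, densityCutoff, h, if_true]
      rw [lintegral_sub_right_eq_self (fun r => ‖f r‖ₑ ^ 2), hf1]
    · simp [hχdef, densityCutoff, h]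
  have hwae : ∀ᵐ r, ∀ n, ∫⁻ x, ‖w r n x‖ₑ ^ 2 ≠ ⊤ := by
    rw [ae_all_iff]
    intro n
    refine (ae_lt_top (hwe n).lintegral_prod_right' (ne_top_of_le_ne_top (hvint n) ?_)).mono
      fun r hr => hr.ne
    simp only
    rw [lintegral_lintegral_swap (hwe n).aemeasurable]
    refine lintegral_mono fun x => ?_
    simp_rw [hwsq]
    rw [lintegral_mul_const' _ _ (by finiteness)]
    exact mul_le_of_le_one_left zero_le (hχ1 x)
  set D : ℕ → ℝ → ℝ≥0∞ := fun k r => ∑ j : Fin d, ∑' n, ENNReal.ofReal (((k : ℝ) + 1) ^ 2) *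
        ∫⁻ x, ‖w r n (x + (1 / ((k : ℝ) + 1)) • EuclideanSpace.single j (1 : ℝ)) -
          w r n x‖ₑ ^ 2 with hD
  have hdiffm : ∀ (y : Space d) n, Measurable fun r => ∫⁻ x, ‖w r n (x + y) - w r n x‖ₑ ^ 2 := by
    intro y n
    have h1 : Measurable fun p : ℝ × Space d => w p.1 n (p.2 + y) :=
      (hwm n).comp (measurable_fst.prodMk (measurable_snd.add_const y))
    exact ((h1.sub (hwm n)).enorm.pow_const 2).lintegral_prod_right'
  have hDm : ∀ k, Measurable (D k) := fun k =>
    Finset.measurable_sum _ fun j _ => Measurable.tsum fun n => (hdiffm _ n).const_mul _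
  -- The bound is uniform in the step size: the factor `(k + 1)²` of the difference quotient cancels
  -- the square of the step.
  have hDint : ∀ k, ∫⁻ r, D k r ≤ ∑ j, (T j + ENNReal.ofReal (4 / (d : ℝ) ^ 2) * R * G j) := by
    intro k
    rw [lintegral_finsetSum _ fun j _ => Measurable.tsum fun n => (hdiffm _ n).const_mul _]
    refine Finset.sum_le_sum fun j _ => ?_
    simp_rw [ENNReal.tsum_mul_left]
    rw [lintegral_const_mul' _ _ ENNReal.ofReal_ne_top]
    have hk : (0 : ℝ) < (k : ℝ) + 1 := by positivity
    have hone : ENNReal.ofReal (((k : ℝ) + 1) ^ 2) * ENNReal.ofReal ((1 / ((k : ℝ) + 1)) ^ 2) = 1 := by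
      rw [← ENNReal.ofReal_mul (by positivity), ← mul_pow, mul_one_div_cancel hk.ne']
      simp
    calc _ ≤ ENNReal.ofReal (((k : ℝ) + 1) ^ 2) * _ :=
          mul_le_mul_right (lintegral_translate_densityCutoff_le hd hf hf1 hR hv hρm hρ0 hvρ hK
            ((1 / ((k : ℝ) + 1)) • EuclideanSpace.single j (1 : ℝ))) _
      _ ≤ ENNReal.ofReal (((k : ℝ) + 1) ^ 2) * (ENNReal.ofReal ((1 / ((k : ℝ) + 1)) ^ 2) * T j +
            ENNReal.ofReal (4 / (d : ℝ) ^ 2) * R *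
              (ENNReal.ofReal ((1 / ((k : ℝ) + 1)) ^ 2) * G j)) := by
          gcongr
          · exact hT j _
          · exact hG j _
      _ = (ENNReal.ofReal (((k : ℝ) + 1) ^ 2) * ENNReal.ofReal ((1 / ((k : ℝ) + 1)) ^ 2)) *
          (T j + ENNReal.ofReal (4 / (d : ℝ) ^ 2) * R * G j) := by ring
      _ = _ := by rw [hone, one_mul]
  have hbath : ∀ᵐ r, ENNReal.ofReal c * (ENNReal.ofReal (Real.exp (2 * r)) *
      ∑' n, ∫⁻ x, ‖w r n x‖ₑ ^ 2) ≤ liminf (fun k => D k r) atTop +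
        ENNReal.ofReal (phaseSpaceConst d * c ^ ((d : ℝ) / 2 + 1)) *
          (ENNReal.ofReal (Real.exp (((d : ℝ) + 2) * r)) * B r) := by
    filter_upwards [hBae, hwae] with r hBr hwr
    have hχL2 : MemLp (χ r) 2 := memLp_two_of_lintegral (hχr r).aestronglyMeasurable hBr
    have hw2 : ∀ n, MemLp (w r n) 2 := fun n =>
      memLp_two_of_lintegral (hwx r n).aestronglyMeasurable (hwr n)
    have hw1 : ∀ n, Integrable (w r n) := fun n =>
      (hχL2.ofReal (K := ℂ)).integrable_mul (hvL2 n)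
    -- The threshold `c * e^{2r}` has power `d/2 + 1` proportional to `e^{(d+2)r}`, matching the
    -- weights in the normalization `hf2` and in the moment.
    have h := bathtub_le_liminf hd hw1 hw2 hBr (tsum_enorm_fourier_sq_le hbessel hχL2)
      (m := c * Real.exp (2 * r)) (by positivity)
    rw [ENNReal.ofReal_mul hc, mul_assoc] at h
    refine h.trans (add_le_add le_rfl (le_of_eq ?_))
    rw [mul_comm, ← mul_assoc, ← ENNReal.ofReal_mul' (Real.exp_nonneg _)]
    congr 2
    rw [Real.mul_rpow hc (Real.exp_nonneg _), ← Real.exp_mul, phaseSpaceConst,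
      show 2 * r * ((d : ℝ) / 2 + 1) = ((d : ℝ) + 2) * r by ring]
    ring
  -- Integration over `r` first gives `∫ (min ρ K)^{2/d} ρ`, with the full density; it is then
  -- lowered to the truncated power.
  have hLHS : ENNReal.ofReal c * I ≤ ∫⁻ r, ENNReal.ofReal c * (ENNReal.ofReal (Real.exp (2 * r)) *
      ∑' n, ∫⁻ x, ‖w r n x‖ₑ ^ 2) := by
    rw [lintegral_const_mul' _ _ ENNReal.ofReal_ne_top]
    gcongr
    have h1 : ∀ r, ENNReal.ofReal (Real.exp (2 * r)) * ∑' n, ∫⁻ x, ‖w r n x‖ₑ ^ 2 =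
        ∫⁻ x, ENNReal.ofReal (Real.exp (2 * r)) * ‖χ r x‖ₑ ^ 2 * ENNReal.ofReal (ρ x) := by
      intro r
      have hwr : ∀ n, Measurable fun x => ‖w r n x‖ₑ ^ 2 := fun n =>
        (hwx r n).enorm.pow_const 2
      rw [← lintegral_tsum fun n => (hwr n).aemeasurable,
        ← lintegral_const_mul' _ _ ENNReal.ofReal_ne_top]
      refine lintegral_congr fun x => ?_
      simp_rw [hwsq]
      rw [ENNReal.tsum_mul_left, hvρ, mul_assoc]
    simp_rw [h1]
    rw [lintegral_lintegral_swap ((((hexpm _).comp measurable_fst).mul hχe).mul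
      (hρm.comp measurable_snd).ennreal_ofReal).aemeasurable]
    refine lintegral_mono fun x => ?_
    rw [lintegral_mul_const' _ _ ENNReal.ofReal_ne_top,
      lintegral_exp_mul_densityCutoff f hK (by positivity) (hρ0 x), hf2, mul_one, hσpow, mul_comm,
      ENNReal.ofReal_mul (Real.rpow_nonneg (le_min (hρ0 x) hK.le) _)]
    gcongr
    exact min_le_left _ _
  calc ENNReal.ofReal c * I ≤ _ := hLHS
    _ ≤ ∫⁻ r, (liminf (fun k => D k r) atTop +
        ENNReal.ofReal (phaseSpaceConst d * c ^ ((d : ℝ) / 2 + 1)) *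
          (ENNReal.ofReal (Real.exp (((d : ℝ) + 2) * r)) * B r)) := lintegral_mono_ae hbath
    _ = (∫⁻ r, liminf (fun k => D k r) atTop) +
        ENNReal.ofReal (phaseSpaceConst d * c ^ ((d : ℝ) / 2 + 1)) * (M * I) := by
        rw [lintegral_add_left (Measurable.liminf hDm),
          lintegral_const_mul' _ _ ENNReal.ofReal_ne_top, hBint]
    _ ≤ _ := by
        gcongr
        refine (lintegral_liminf_le hDm).trans ?_
        refine (liminf_le_liminf (Eventually.of_forall hDint)).trans_eq ?_
        exact liminf_const _

end LocalizedBound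

/-! ### From weak derivatives to difference bounds. -/

section WeakDerivatives

variable {d : ℕ}

lemma lintegral_translate_sub_sq_congr {F : Type*} [NormedAddCommGroup F] {u v : Space d → F}
    (h : u =ᵐ[volume] v) (y : Space d) :
    ∫⁻ x, ‖u (x + y) - u x‖ₑ ^ 2 = ∫⁻ x, ‖v (x + y) - v x‖ₑ ^ 2 := by
  have h' : ∀ᵐ x, u (x + y) = v (x + y) :=
    (measurePreserving_add_right volume y).quasiMeasurePreserving.ae h
  refine lintegral_congr_ae ?_
  filter_upwards [h, h'] with x h1 h2
  rw [h1, h2]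

/-- Testing with real-valued functions separates real and imaginary parts, so the real translation
bound applies to each and the two results add up. -/
lemma lintegral_translate_sub_sq_le_of_schwartz {u g : L2 d} {e : Space d}
    (h : ∀ f : 𝓢(Space d, ℂ), inner ℂ u ((∂_{e} f).toLp 2 volume) =
      -inner ℂ g (f.toLp 2 volume)) (t : ℝ) :
    ∫⁻ x, ‖u (x + t • e) - u x‖ₑ ^ 2 ≤ ENNReal.ofReal (t ^ 2) * ‖g‖ₑ ^ 2 := by
  have hu := Lp.memLp u
  have hg := Lp.memLp g
  have hsplit : ∀ z : ℂ, ‖z‖ₑ ^ 2 = ‖z.re‖ₑ ^ 2 + ‖z.im‖ₑ ^ 2 := by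
    intro z
    rw [enorm_sq_eq_ofReal, enorm_sq_eq_ofReal, enorm_sq_eq_ofReal,
      ← ENNReal.ofReal_add (by positivity) (by positivity), Complex.sq_norm, Complex.normSq_apply]
    simp [sq]
  have key : ∀ φ : Space d → ℝ, ContDiff ℝ ∞ φ → HasCompactSupport φ →
      ∫ x, ((fderiv ℝ φ x e : ℝ) : ℂ) * (starRingEnd ℂ) (u x) =
        -∫ x, (φ x : ℂ) * (starRingEnd ℂ) (g x) ∧
      Integrable (fun x => ((fderiv ℝ φ x e : ℝ) : ℂ) * (starRingEnd ℂ) (u x)) ∧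
      Integrable (fun x => (φ x : ℂ) * (starRingEnd ℂ) (g x)) := by
    intro φ hφ hφc
    have hcs : ContDiff ℝ ∞ fun x => (φ x : ℂ) := Complex.ofRealCLM.contDiff.comp hφ
    have hcc : HasCompactSupport fun x => (φ x : ℂ) := hφc.comp_left Complex.ofReal_zero
    set ψ : 𝓢(Space d, ℂ) := hcc.toSchwartzMap hcs with hψ
    have hψapp : ∀ x, ψ x = (φ x : ℂ) := fun x => rfl
    have hdψ : ∀ x, (∂_{e} ψ) x = ((fderiv ℝ φ x e : ℝ) : ℂ) := by
      intro x
      rw [SchwartzMap.lineDerivOp_apply_eq_fderiv]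
      have := (Complex.ofRealCLM.hasFDerivAt.comp x
        (hφ.differentiable (by simp) x).hasFDerivAt).fderiv
      exact congrArg (fun L : Space d →L[ℝ] ℂ => L e) this
    have e1 : (fun x => inner ℂ (u x) ((∂_{e} ψ).toLp 2 volume x)) =ᵐ[volume]
        fun x => ((fderiv ℝ φ x e : ℝ) : ℂ) * (starRingEnd ℂ) (u x) := by
      filter_upwards [(∂_{e} ψ).coeFn_toLp 2 volume] with x hx
      rw [hx, hdψ]
      rfl
    have e2 : (fun x => inner ℂ (g x) (ψ.toLp 2 volume x)) =ᵐ[volume]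
        fun x => (φ x : ℂ) * (starRingEnd ℂ) (g x) := by
      filter_upwards [ψ.coeFn_toLp 2 volume] with x hx
      rw [hx, hψapp]
      rfl
    have := h ψ
    rw [L2.inner_def, L2.inner_def, integral_congr_ae e1, integral_congr_ae e2] at this
    exact ⟨this, (L2.integrable_inner u _).congr e1, (L2.integrable_inner g _).congr e2⟩
  have hre := lintegral_translate_sub_sq_le (u := fun x => (u x).re) (g := fun x => (g x).re)
    hu.re hg.re e (fun φ hφ hφc => by
      obtain ⟨h1, i1, i2⟩ := key φ hφ hφc
      have h2 := congrArg Complex.re h1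
      rw [Complex.neg_re, ← RCLike.re_eq_complex_re, ← integral_re i1, ← integral_re i2] at h2
      simpa [mul_comm] using h2) t
  have him := lintegral_translate_sub_sq_le (u := fun x => (u x).im) (g := fun x => (g x).im)
    hu.im hg.im e (fun φ hφ hφc => by
      obtain ⟨h1, i1, i2⟩ := key φ hφ hφc
      have h2 := congrArg Complex.im h1
      rw [Complex.neg_im, ← RCLike.im_eq_complex_im, ← integral_im i1, ← integral_im i2] at h2
      simp only [RCLike.im_eq_complex_im, Complex.im_ofReal_mul, Complex.conj_im, mul_neg,
        integral_neg, neg_neg] at h2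
      rw [neg_eq_iff_eq_neg] at h2
      simpa [mul_comm] using h2) t
  have hum : Measurable (u : Space d → ℂ) := (Lp.stronglyMeasurable u).measurable
  have hgm : Measurable (g : Space d → ℂ) := (Lp.stronglyMeasurable g).measurable
  have m1 : Measurable fun x => ‖(u (x + t • e)).re - (u x).re‖ₑ ^ 2 :=
    ((Complex.measurable_re.comp (hum.comp (measurable_id.add_const _))).sub
      (Complex.measurable_re.comp hum)).enorm.pow_const 2
  have m2 : Measurable fun x => ‖(g x).re‖ₑ ^ 2 :=
    (Complex.measurable_re.comp hgm).enorm.pow_const 2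
  calc ∫⁻ x, ‖u (x + t • e) - u x‖ₑ ^ 2 = (∫⁻ x, ‖(u (x + t • e)).re - (u x).re‖ₑ ^ 2) +
        ∫⁻ x, ‖(u (x + t • e)).im - (u x).im‖ₑ ^ 2 := by
        rw [← lintegral_add_left m1]
        refine lintegral_congr fun x => ?_
        rw [hsplit, Complex.sub_re, Complex.sub_im]
    _ ≤ _ := add_le_add hre him
    _ = _ := by
        rw [← mul_add, ← lintegral_add_left m2, Lp_enorm_sq]
        congr 1
        exact lintegral_congr fun x => (hsplit _).symm

/-- Finite difference form of the Dirichlet integral. -/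
lemma HasWeakGradientOn.exists_translate_bound {s : Space d → ℝ} {G : Space d → Space d}
    (hG : HasWeakGradientOn univ s G) (hs : MemLp s 2) {E : ℝ≥0∞}
    (hE : E = ∫⁻ x in univ, ENNReal.ofReal (‖G x‖ ^ 2 * 1)) (hEtop : E ≠ ⊤) :
    ∃ g : Fin d → ℝ≥0∞, ∑ j, g j = E ∧ ∀ j t,
      ∫⁻ x, ‖s (x + t • EuclideanSpace.single j (1 : ℝ)) - s x‖ₑ ^ 2 ≤
        ENNReal.ofReal (t ^ 2) * g j := by
  have hGm : AEStronglyMeasurable G volume :=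
    (locallyIntegrableOn_univ.1 hG.locallyIntegrableOn_grad).aestronglyMeasurable
  have hGjm : ∀ j, AEStronglyMeasurable (fun x => G x j) volume := fun j =>
    (EuclideanSpace.proj j : Space d →L[ℝ] ℝ).continuous.comp_aestronglyMeasurable hGm
  have hsum : ∑ j, ∫⁻ x, ‖G x j‖ₑ ^ 2 = E := by
    rw [hE, Measure.restrict_univ, ← lintegral_finsetSum' _ fun j _ => (hGjm j).enorm.pow_const 2]
    refine lintegral_congr fun x => ?_
    rw [mul_one, EuclideanSpace.norm_sq_eq, ENNReal.ofReal_sum_of_nonneg fun _ _ => by positivity]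
    exact Finset.sum_congr rfl fun j _ => enorm_sq_eq_ofReal _
  refine ⟨fun j => ∫⁻ x, ‖G x j‖ₑ ^ 2, hsum, fun j t => ?_⟩
  have hGj : MemLp (fun x => G x j) 2 := memLp_two_of_lintegral (hGjm j)
    (ne_top_of_le_ne_top hEtop (hsum ▸ Finset.single_le_sum
      (f := fun j => ∫⁻ x, ‖G x j‖ₑ ^ 2) (fun _ _ => zero_le) (Finset.mem_univ j)))
  refine lintegral_translate_sub_sq_le hs hGj _ (fun φ hφ hφc => ?_) t
  have := hG.integral_eq φ hφ hφc (subset_univ _) (EuclideanSpace.single j (1 : ℝ))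
  simpa [EuclideanSpace.inner_single_right] using this

end WeakDerivatives

/-! ### Profiles in the logarithmic variable. -/

section LogVariable

lemma image_exp_univ : Real.exp '' univ = Ioi 0 := by
  rw [image_univ, Real.range_exp]

lemma lintegral_Ioi_eq_lintegral_exp (g : ℝ → ℝ≥0∞) :
    ∫⁻ t in Ioi (0 : ℝ), g t = ∫⁻ r, ENNReal.ofReal (Real.exp r) * g (Real.exp r) := by
  rw [← image_exp_univ, lintegral_image_eq_lintegral_abs_deriv_mul MeasurableSet.univ
    (fun x _ => (Real.hasDerivAt_exp x).hasDerivWithinAt) Real.exp_injective.injOn,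
    Measure.restrict_univ]
  simp [abs_of_pos (Real.exp_pos _)]

lemma integral_Ioi_eq_integral_exp (g : ℝ → ℝ) :
    ∫ t in Ioi (0 : ℝ), g t = ∫ r, Real.exp r * g (Real.exp r) := by
  rw [← image_exp_univ, integral_image_eq_integral_abs_deriv_smul MeasurableSet.univ
    (fun x _ => (Real.hasDerivAt_exp x).hasDerivWithinAt) Real.exp_injective.injOn,
    Measure.restrict_univ]
  simp [abs_of_pos (Real.exp_pos _)]

/-- A test function on `ℝ` becomes a test function on `(0, ∞)` in the logarithmic variable. -/
lemma exists_testFunction_comp_log {ψ : ℝ → ℝ} (hψ : ContDiff ℝ ∞ ψ) (hψc : HasCompactSupport ψ) :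
    ∃ φ : ℝ → ℝ, ContDiff ℝ ∞ φ ∧ HasCompactSupport φ ∧ tsupport φ ⊆ Ioi 0 ∧
      (∀ r, φ (Real.exp r) = ψ r) ∧
      ∀ r, fderiv ℝ φ (Real.exp r) 1 = Real.exp (-r) * fderiv ℝ ψ r 1 := by
  set φ : ℝ → ℝ := fun t => if 0 < t then ψ (Real.log t) else 0 with hφ
  set C := Real.exp '' tsupport ψ with hC
  have hCc : IsCompact C := hψc.isCompact.image Real.continuous_exp
  have hC0 : C ⊆ Ioi 0 := by rintro _ ⟨r, -, rfl⟩; exact Real.exp_pos r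
  have hout : ∀ t, t ∉ C → φ t = 0 := by
    intro t ht
    by_cases h : 0 < t
    · simp only [hφ, h, if_true]
      refine image_eq_zero_of_notMem_tsupport fun hmem => ht ⟨_, hmem, Real.exp_log h⟩
    · simp [hφ, h]
  have hloc : ∀ t, 0 < t → φ =ᶠ[𝓝 t] fun t => ψ (Real.log t) := fun t ht =>
    (lt_mem_nhds ht).mono fun s hs => by simp only [hφ, hs, if_true]
  refine ⟨φ, ?_, HasCompactSupport.intro hCc hout, ?_, fun r => ?_, fun r => ?_⟩
  · refine contDiff_iff_contDiffAt.2 fun t => ?_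
    by_cases h : 0 < t
    · exact ((hψ.contDiffAt).comp t (Real.contDiffAt_log.2 h.ne')).congr_of_eventuallyEq (hloc t h)
    · have : φ =ᶠ[𝓝 t] fun _ => 0 :=
        Filter.mem_of_superset (hCc.isClosed.isOpen_compl.mem_nhds fun hc => h (hC0 hc)) hout
      exact contDiffAt_const.congr_of_eventuallyEq this
  · refine (closure_minimal ?_ hCc.isClosed).trans hC0
    intro t ht
    by_contra h
    exact ht (hout t h)
  · simp [hφ, Real.exp_pos]
  · rw [(hloc _ (Real.exp_pos r)).fderiv_eq]
    have h1 : HasFDerivAt ψ (fderiv ℝ ψ (Real.log (Real.exp r))) (Real.log (Real.exp r)) :=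
      (hψ.differentiable (by simp) _).hasFDerivAt
    have h2 := (h1.comp (Real.exp r)
      (Real.hasDerivAt_log (Real.exp_pos r).ne').hasFDerivAt).fderiv
    rw [show (fun t => ψ (Real.log t)) = ψ ∘ Real.log from rfl, h2]
    simp [Real.exp_neg]

/-- Under `t = eʳ` the function `η(eʳ)` has weak derivative `eʳ g(eʳ)`, whose squared norm in `dr`
is `∫ g(t)² t dt`. -/
lemma lintegral_exp_translate_sub_sq_le {η g : ℝ → ℝ} (hη : Measurable η) (hg : Measurable g)
    (hη1 : ∫⁻ r, ‖η (Real.exp r)‖ₑ ^ 2 ≠ ⊤)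
    (h : ∀ φ : ℝ → ℝ, ContDiff ℝ ∞ φ → HasCompactSupport φ → tsupport φ ⊆ Ioi 0 →
      ∫ t in Ioi (0 : ℝ), η t * fderiv ℝ φ t 1 = -∫ t in Ioi (0 : ℝ), φ t * g t)
    {E : ℝ≥0∞} (hE : E = ∫⁻ t in Ioi (0 : ℝ), ENNReal.ofReal (‖g t‖ ^ 2 * t)) (hEtop : E ≠ ⊤)
    (a : ℝ) :
    ∫⁻ r, ‖η (Real.exp (r + a)) - η (Real.exp r)‖ₑ ^ 2 ≤ ENNReal.ofReal (a ^ 2) * E := by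
  have hEe : E = ∫⁻ r, ‖Real.exp r * g (Real.exp r)‖ₑ ^ 2 := by
    rw [hE, lintegral_Ioi_eq_lintegral_exp]
    refine lintegral_congr fun r => ?_
    rw [enorm_sq_eq_ofReal, ← ENNReal.ofReal_mul (Real.exp_nonneg _), norm_mul, Real.norm_of_nonneg (Real.exp_nonneg r)]
    ring_nf
  have hfm : MemLp (fun r => η (Real.exp r)) 2 :=
    memLp_two_of_lintegral (hη.comp Real.measurable_exp).aestronglyMeasurable hη1
  have hgm : MemLp (fun r => Real.exp r * g (Real.exp r)) 2 :=
    memLp_two_of_lintegral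
      (Real.measurable_exp.mul (hg.comp Real.measurable_exp)).aestronglyMeasurable (hEe ▸ hEtop)
  have := lintegral_translate_sub_sq_le hfm hgm (1 : ℝ) (fun ψ hψ hψc => by
    obtain ⟨φ, h1, h2, h3, h4, h5⟩ := exists_testFunction_comp_log hψ hψc
    have h6 := h φ h1 h2 h3
    rw [integral_Ioi_eq_integral_exp, integral_Ioi_eq_integral_exp] at h6
    simp only [h4, h5] at h6
    refine Eq.trans (integral_congr_ae (Eventually.of_forall fun r => ?_)) (h6.trans ?_)
    · simp only
      rw [Real.exp_neg]
      field_simp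
    · congr 1
      refine integral_congr_ae (Eventually.of_forall fun r => ?_)
      simp only
      ring) a
  rw [← hEe] at this
  simpa using this

end LogVariable

/-- Passes from a bound for every weak gradient to one for the Dirichlet integral, which is an
infimum. The factor has to be nonzero because the infimum may be empty, and `0 * ⊤ = 0`. -/
lemma le_mul_iInf₂ {ι : Type*} {p : ι → Prop} {F : (i : ι) → p i → ℝ≥0∞} {a x : ℝ≥0∞}
    (h0 : a ≠ 0) (ha : a ≠ ⊤) (h : ∀ i hi, x ≤ a * F i hi) : x ≤ a * ⨅ (i) (hi), F i hi := by
  rw [← ENNReal.div_le_iff' h0 ha]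
  exact le_iInf₂ fun i hi => (ENNReal.div_le_iff' h0 ha).2 (h i hi)

/-- A normalized profile in the logarithmic variable. -/
lemma IsNormalized.exists_log_profile {η : ℝ → ℝ} (hη : IsNormalized η) :
    ∃ f : ℝ → ℝ, Measurable f ∧ ∫⁻ r, ‖f r‖ₑ ^ 2 = 1 ∧
      ∫⁻ r, ENNReal.ofReal (Real.exp (2 * r)) * ‖f r‖ₑ ^ 2 = 1 ∧
      (∀ d : ℕ, ∫⁻ r, ENNReal.ofReal (Real.exp (((d : ℝ) + 2) * r)) * ‖f r‖ₑ ^ 2 = moment d η) ∧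
      ∀ a : ℝ, ∫⁻ r, ‖f (r + a) - f r‖ₑ ^ 2 ≤ ENNReal.ofReal (a ^ 2) * radialEnergy η := by
  set η₀ := hη.aestronglyMeasurable.mk η with hη₀
  have hη₀m : Measurable η₀ := hη.aestronglyMeasurable.stronglyMeasurable_mk.measurable
  have hae : η =ᵐ[volume.restrict (Ioi 0)] η₀ := hη.aestronglyMeasurable.ae_eq_mk
  have hchange : ∀ p : ℝ → ℝ,
      ∫⁻ t in Ioi (0 : ℝ), ENNReal.ofReal (η t ^ 2 * p t) =
        ∫⁻ r, ENNReal.ofReal (Real.exp r * p (Real.exp r)) * ‖η₀ (Real.exp r)‖ₑ ^ 2 := by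
    intro p
    have h1 : ∫⁻ t in Ioi (0 : ℝ), ENNReal.ofReal (η t ^ 2 * p t) =
        ∫⁻ t in Ioi (0 : ℝ), ENNReal.ofReal (η₀ t ^ 2 * p t) :=
      lintegral_congr_ae (hae.mono fun t ht => by simp only [ht])
    rw [h1, lintegral_Ioi_eq_lintegral_exp]
    refine lintegral_congr fun r => ?_
    rw [enorm_sq_eq_ofReal, ← ENNReal.ofReal_mul (Real.exp_nonneg _),
      ← ENNReal.ofReal_mul' (by positivity), Real.norm_eq_abs, sq_abs]
    ring_nf
  have hf1 : ∫⁻ r, ‖η₀ (Real.exp r)‖ₑ ^ 2 = 1 := by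
    have h := hη.lintegral_div
    simp only [div_eq_mul_inv] at h
    rw [hchange fun t => t⁻¹] at h
    simpa [mul_inv_cancel₀ (Real.exp_pos _).ne'] using h
  refine ⟨fun r => η₀ (Real.exp r), hη₀m.comp Real.measurable_exp, hf1, ?_, fun d => ?_,
    fun a => ?_⟩
  · have h := hη.lintegral_mul
    rw [hchange fun t => t] at h
    rw [← h]
    refine lintegral_congr fun r => ?_
    rw [← Real.exp_add, two_mul]
  · rw [moment, hchange fun t => t ^ (d + 1)]
    refine lintegral_congr fun r => ?_
    rw [← pow_succ', ← Real.exp_nat_mul]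
    push_cast
    ring_nf
  · rcases eq_or_ne a 0 with rfl | ha
    · simp
    have ha2 : 0 < a ^ 2 := by positivity
    have ha2' : ENNReal.ofReal (a ^ 2) ≠ 0 := (ENNReal.ofReal_pos.2 ha2).ne'
    refine le_mul_iInf₂ ha2' ENNReal.ofReal_ne_top fun G hG => ?_
    rcases eq_or_ne (∫⁻ t in Ioi (0 : ℝ), ENNReal.ofReal (‖G t‖ ^ 2 * t)) ⊤ with htop | htop
    · rw [htop, ENNReal.mul_top ha2']
      exact le_top
    have hGm : AEStronglyMeasurable G (volume.restrict (Ioi 0)) :=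
      hG.locallyIntegrableOn_grad.aestronglyMeasurable
    have hGae : G =ᵐ[volume.restrict (Ioi 0)] hGm.mk G := hGm.ae_eq_mk
    refine lintegral_exp_translate_sub_sq_le hη₀m hGm.stronglyMeasurable_mk.measurable
      (by rw [hf1]; exact ENNReal.one_ne_top) (fun φ h1 h2 h3 => ?_)
      (lintegral_congr_ae (hGae.mono fun t ht => by simp only [ht])) htop a
    have h4 := hG.integral_eq φ h1 h2 h3 1
    have e1 : ∫ t in Ioi (0 : ℝ), η t * fderiv ℝ φ t 1 =
        ∫ t in Ioi (0 : ℝ), η₀ t * fderiv ℝ φ t 1 :=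
      integral_congr_ae (hae.mono fun t ht => by simp only [ht])
    have e2 : ∫ t in Ioi (0 : ℝ), φ t * inner ℝ (G t) 1 =
        ∫ t in Ioi (0 : ℝ), φ t * hGm.mk G t :=
      integral_congr_ae (hGae.mono fun t ht => by simp [← ht])
    rw [← e1, ← e2, h4]

/-- With zero energy the profile in `ln t` would be translation invariant and square integrable,
hence zero, against the normalization. -/
lemma IsNormalized.radialEnergy_ne_zero {η : ℝ → ℝ} (hη : IsNormalized η) :
    radialEnergy η ≠ 0 := by
  intro h0
  obtain ⟨f, hf, hf1, -, -, hR⟩ := hη.exists_log_profile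
  have hmem : MemLp f 2 := memLp_two_of_lintegral hf.aestronglyMeasurable (by simp [hf1])
  have := lintegral_sq_eq_zero_of_translate_invariant hmem one_ne_zero (fun t => by
    have := hR t
    rw [h0, mul_zero] at this
    simpa using this)
  rw [hf1] at this
  exact one_ne_zero this

lemma moment_ne_zero {η : ℝ → ℝ} (hη : IsNormalized η) (d : ℕ) : moment d η ≠ 0 := by
  intro h0
  obtain ⟨f, hf, hf1, -, hM, -⟩ := hη.exists_log_profile
  rw [← hM d, lintegral_eq_zero_iff (by fun_prop)] at h0
  have : ∫⁻ r, ‖f r‖ₑ ^ 2 = 0 := by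
    rw [lintegral_eq_zero_iff (by fun_prop)]
    filter_upwards [h0] with r hr
    have h1 : ENNReal.ofReal (Real.exp (((d : ℝ) + 2) * r)) ≠ 0 := by simpa using Real.exp_pos _
    exact (mul_eq_zero.1 hr).resolve_left h1
  rw [hf1] at this
  exact one_ne_zero this

/-- The witness is the critical point of `c ↦ c - L M c^{1+d/2}`, with `L` the phase space constant.
There the subtracted term equals `c / (1 + d/2)`, so the value is `c d / (d + 2)`. The identity is
additive so that it can be used in `[0, ∞]`. -/
lemma phaseSpaceConst_mul_rpow {d : ℕ} (hd : 1 ≤ d) {M : ℝ} (hM : 0 < M) :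
    ∃ c : ℝ, 0 ≤ c ∧ thomasFermi d / M ^ (2 / (d : ℝ)) +
      phaseSpaceConst d * c ^ ((d : ℝ) / 2 + 1) * M = c := by
  have hd0 : (0 : ℝ) < d := by exact_mod_cast hd
  have hpi := Real.pi_pos
  have hΓ : 0 < Real.Gamma (1 + (d : ℝ) / 2) := Real.Gamma_pos_of_pos (by positivity)
  set Γ := Real.Gamma (1 + (d : ℝ) / 2) with hΓdef
  set c := 4 * Real.pi * (Γ ^ (2 / (d : ℝ)) / M ^ (2 / (d : ℝ))) with hc
  have hc0 : 0 < c := by positivity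
  have hinv : ∀ y : ℝ, 0 < y → (y ^ (2 / (d : ℝ))) ^ ((d : ℝ) / 2) = y := by
    intro y hy
    rw [← Real.rpow_mul hy.le, div_mul_div_comm, mul_comm, div_self (by positivity), Real.rpow_one]
  have hcpow : c ^ ((d : ℝ) / 2) = 2 ^ d * √Real.pi ^ d * (Γ / M) := by
    rw [hc, Real.mul_rpow (by positivity) (by positivity), Real.div_rpow (by positivity)
      (by positivity), hinv _ hΓ, hinv _ hM, Real.mul_rpow (by positivity) hpi.le]
    congr 2
    · rw [show (4 : ℝ) = 2 ^ (2 : ℝ) by norm_num, ← Real.rpow_mul (by norm_num),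
        mul_div_cancel₀ _ two_ne_zero, Real.rpow_natCast]
    · rw [Real.sqrt_eq_rpow, ← Real.rpow_natCast, ← Real.rpow_mul hpi.le]
      ring_nf
  refine ⟨c, hc0.le, ?_⟩
  have hsq : √Real.pi ^ d * √Real.pi ^ d = Real.pi ^ d := by
    rw [← mul_pow, Real.mul_self_sqrt hpi.le]
  have h1 : phaseSpaceConst d * c ^ ((d : ℝ) / 2 + 1) * M = c / ((d : ℝ) / 2 + 1) := by
    rw [Real.rpow_add_one hc0.ne', hcpow, phaseSpaceConst, add_comm ((d : ℝ) / 2) 1, ← hΓdef,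
      mul_pow, ← hsq]
    field_simp
  rw [h1, thomasFermi, ← hΓdef, hc]
  field_simp

/-! ### The bound for a general profile. -/

section MainBound

variable {d : ℕ} {γ : L2 d →L[ℂ] L2 d} {ρ : Space d → ℝ}

/-- The sum is `⟨F, γ F⟩` for `F` the complex conjugate of `φ`, and `γ ≤ 1`. This is the only place
where the Pauli bound enters. -/
lemma tsum_enorm_integral_sq_le (hγ_le : γ ≤ 1) {u : ℕ → L2 d} {v : ℕ → Space d → ℂ}
    (hu : ∀ f, ENNReal.ofReal (inner ℂ f (γ f)).re = ∑' n, ‖inner ℂ (u n) f‖ₑ ^ 2)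
    (huv : ∀ n, u n =ᵐ[volume] v n) {φ : Space d → ℂ} (hφ : MemLp φ 2) :
    ∑' n, ‖∫ x, φ x * v n x‖ₑ ^ 2 ≤ ∫⁻ x, ‖φ x‖ₑ ^ 2 := by
  have hφs : MemLp (fun x => (starRingEnd ℂ) (φ x)) 2 := hφ.star
  set F : L2 d := hφs.toLp with hF
  have h1 : ∀ n, ‖∫ x, φ x * v n x‖ₑ = ‖inner ℂ (u n) F‖ₑ := by
    intro n
    have : (starRingEnd ℂ) (inner ℂ (u n) F) = ∫ x, φ x * v n x := by
      rw [inner_conj_symm, L2.inner_def]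
      refine integral_congr_ae ?_
      filter_upwards [huv n, hφs.coeFn_toLp] with x hx1 hx2
      rw [hx1, hx2]
      simp [mul_comm]
    rw [← this, ← ofReal_norm, ← ofReal_norm, Complex.norm_conj]
  simp_rw [h1]
  rw [← hu]
  have h2 : (inner ℂ F (γ F)).re ≤ ‖F‖ ^ 2 := by
    have h := ((ContinuousLinearMap.le_def _ _).1 hγ_le).re_inner_nonneg_right F
    rw [sub_apply, one_apply_eq_self, inner_sub_right, map_sub,
      inner_self_eq_norm_sq (𝕜 := ℂ) F] at h
    have h' : RCLike.re (inner ℂ F (γ F)) = (inner ℂ F (γ F)).re := rfl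
    linarith
  refine (ENNReal.ofReal_le_ofReal h2).trans_eq ?_
  rw [← enorm_sq_eq_ofReal, hF, Lp.enorm_toLp, eLpNorm_two_sq]
  refine lintegral_congr fun x => ?_
  rw [enorm_sq_eq_ofReal, enorm_sq_eq_ofReal, Complex.norm_conj]

/-- Representatives set to zero on the null set where `∑ |uₙ|²` is infinite, so that the density
formula holds at every point with a real value. The pointwise localization formula needs this. -/
lemma exists_density_representative (hγ_nonneg : 0 ≤ γ) (hγ_trace : opTrace γ ≠ ⊤)
    (hρ : IsDensity γ ρ) :
    ∃ (u : ℕ → L2 d) (v : ℕ → Space d → ℂ) (ρ₀ : Space d → ℝ),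
      (∀ f, ENNReal.ofReal (inner ℂ f (γ f)).re = ∑' n, ‖inner ℂ (u n) f‖ₑ ^ 2) ∧
      (∀ n, u n =ᵐ[volume] v n) ∧ (∀ n, Measurable (v n)) ∧ Measurable ρ₀ ∧ (∀ x, 0 ≤ ρ₀ x) ∧
      (∀ x, ∑' n, ‖v n x‖ₑ ^ 2 = ENNReal.ofReal (ρ₀ x)) ∧
      (∫⁻ x, ENNReal.ofReal (ρ₀ x) ≠ ⊤) ∧ ρ =ᵐ[volume] ρ₀ := by
  obtain ⟨u, hu, hufin⟩ := exists_rankOne_decomposition γ hγ_nonneg hγ_trace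
  have hum : ∀ n, Measurable (u n : Space d → ℂ) := fun n =>
    (Lp.stronglyMeasurable (u n)).measurable
  have husq : ∀ n, Measurable fun x => ‖u n x‖ₑ ^ 2 := fun n => (hum n).enorm.pow_const 2
  set N : Space d → ℝ≥0∞ := fun x => ∑' n, ‖u n x‖ₑ ^ 2 with hN
  have hNm : Measurable N := Measurable.tsum husq
  have hNint : ∫⁻ x, N x ≠ ⊤ := by
    rw [hN, lintegral_tsum fun n => (husq n).aemeasurable]
    simpa only [← Lp_enorm_sq] using hufin
  have hNae : ∀ᵐ x, N x < ⊤ := ae_lt_top hNm hNint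
  set S : Set (Space d) := {x | N x < ⊤} with hS
  have hSm : MeasurableSet S := measurableSet_lt hNm measurable_const
  set v : ℕ → Space d → ℂ := fun n => S.indicator (u n) with hv
  have huv : ∀ n, u n =ᵐ[volume] v n := fun n => by
    filter_upwards [hNae] with x hx
    rw [hv]
    exact (indicator_of_mem (show x ∈ S from hx) _).symm
  have hvsum : ∀ x, ∑' n, ‖v n x‖ₑ ^ 2 = S.indicator N x := by
    intro x
    by_cases hx : x ∈ S <;> simp [hv, hx, hN]
  have hfin : ∀ x, S.indicator N x ≠ ⊤ := by
    intro x
    by_cases hx : x ∈ S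
    · rw [indicator_of_mem hx]; exact ne_of_lt hx
    · simp [hx]
  have hof : ∀ x, ENNReal.ofReal (S.indicator N x).toReal = S.indicator N x := fun x =>
    ENNReal.ofReal_toReal (hfin x)
  refine ⟨u, v, fun x => (S.indicator N x).toReal, hu, huv, fun n => (hum n).indicator hSm,
    (hNm.indicator hSm).ennreal_toReal, fun x => ENNReal.toReal_nonneg, fun x => ?_, ?_, ?_⟩
  · rw [hvsum, hof]
  · simp_rw [hof]
    exact ne_top_of_le_ne_top hNint (lintegral_mono fun x => indicator_le_self _ _ _)
  · filter_upwards [hρ.ae_eq_tsum hu, hρ.nonneg, hNae] with x h1 h2 h3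
    rw [indicator_of_mem (show x ∈ S from h3), show N x = _ from h1.symm, ENNReal.toReal_ofReal h2]

lemma kinetic_bound_of_weakGradient (hd : 1 ≤ d) (hγ_nonneg : 0 ≤ γ) (hγ_le : γ ≤ 1)
    (hγ_trace : opTrace γ ≠ ⊤) (hρ : IsDensity γ ρ) {η : ℝ → ℝ} (hη : IsNormalized η)
    {G : Space d → Space d} (hG : HasWeakGradientOn univ (fun x => √(ρ x)) G) {E : ℝ≥0∞}
    (hE : E = ∫⁻ x in univ, ENNReal.ofReal (‖G x‖ ^ 2 * 1)) (hEtop : E ≠ ⊤) :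
    ENNReal.ofReal (thomasFermi d) / moment d η ^ (2 / (d : ℝ)) * thomasFermiIntegral ρ ≤
      kineticEnergy γ + ENNReal.ofReal (4 / (d : ℝ) ^ 2) * radialEnergy η * E := by
  have hd0 : (0 : ℝ) < d := by exact_mod_cast hd
  rcases eq_or_ne (moment d η) ⊤ with hM | hMtop
  · rw [hM, ENNReal.top_rpow_of_pos (by positivity), ENNReal.div_top, zero_mul]
    exact zero_le
  rcases eq_or_ne (kineticEnergy γ) ⊤ with hT | hTtop
  · rw [hT, top_add]
    exact le_top
  obtain ⟨f, hf, hf1, hf2, hfM, hfR⟩ := hη.exists_log_profile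
  obtain ⟨u, v, ρ₀, hu, huv, hvm, hρ₀m, hρ₀0, hvρ, hρint, hae⟩ :=
    exists_density_representative hγ_nonneg hγ_trace hρ
  obtain ⟨g, hg, hgT⟩ := exists_weakDeriv_of_kineticEnergy_ne_top hγ_nonneg hu hTtop
  have hsL2 : MemLp (fun x => √(ρ x)) 2 := by
    refine memLp_two_of_lintegral
      (Real.continuous_sqrt.comp_aestronglyMeasurable hρ.aestronglyMeasurable) ?_
    refine ne_top_of_le_ne_top hρint (le_of_eq (lintegral_congr_ae ?_))
    filter_upwards [hae] with x hx
    rw [hx, enorm_sq_eq_ofReal, Real.norm_eq_abs, sq_abs, Real.sq_sqrt (hρ₀0 x)]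
  obtain ⟨e, he, hbound⟩ := hG.exists_translate_bound hsL2 hE hEtop
  have hsae : (fun x => √(ρ x)) =ᵐ[volume] fun x => √(ρ₀ x) := hae.mono fun x hx => by
    simp only [hx]
  have hMpos : 0 < (moment d η).toReal := ENNReal.toReal_pos (moment_ne_zero hη d) hMtop
  obtain ⟨c, hc0, hc⟩ := phaseSpaceConst_mul_rpow hd hMpos
  set Q := thomasFermi d / (moment d η).toReal ^ (2 / (d : ℝ)) with hQ
  have hΓ : 0 < Real.Gamma (1 + (d : ℝ) / 2) := Real.Gamma_pos_of_pos (by positivity)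
  have htf : 0 ≤ thomasFermi d := by unfold thomasFermi; positivity
  have hQ0 : 0 ≤ Q := by positivity
  have hQe : ENNReal.ofReal (thomasFermi d) / moment d η ^ (2 / (d : ℝ)) = ENNReal.ofReal Q := by
    rw [hQ, ENNReal.ofReal_div_of_pos (by positivity),
      ← ENNReal.ofReal_rpow_of_pos hMpos, ENNReal.ofReal_toReal hMtop]
  have hPS : 0 ≤ phaseSpaceConst d := by
    have : 0 < Real.Gamma ((d : ℝ) / 2 + 1) := Real.Gamma_pos_of_pos (by positivity)
    unfold phaseSpaceConst
    positivity
  have hRHS : ∑ j, (∑' n, ‖g n j‖ₑ ^ 2 + ENNReal.ofReal (4 / (d : ℝ) ^ 2) * radialEnergy η * e j) ≤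
      kineticEnergy γ + ENNReal.ofReal (4 / (d : ℝ) ^ 2) * radialEnergy η * E := by
    rw [Finset.sum_add_distrib, ← Finset.mul_sum, he,
      ← Summable.tsum_finsetSum fun _ _ => ENNReal.summable]
    gcongr
  set X := kineticEnergy γ + ENNReal.ofReal (4 / (d : ℝ) ^ 2) * radialEnergy η * E with hX
  have hcut : ∀ K : ℝ, 0 < K →
      ENNReal.ofReal Q * ∫⁻ x, ENNReal.ofReal (min (ρ₀ x) K ^ (1 + 2 / (d : ℝ))) ≤ X := by
    intro K hK
    obtain ⟨hI, hle⟩ := localized_kinetic_bound hd hf hf1 hf2 (hfM d) hMtop hfR hvm hρ₀m hρ₀0 hvρ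
      hρint (fun φ hφ => tsum_enorm_integral_sq_le hγ_le hu huv hφ)
      (T := fun j => ∑' n, ‖g n j‖ₑ ^ 2) (G := e) (fun j t => by
        rw [← ENNReal.tsum_mul_left]
        refine ENNReal.tsum_le_tsum fun n => ?_
        rw [← lintegral_translate_sub_sq_congr (huv n)]
        exact lintegral_translate_sub_sq_le_of_schwartz (hg n j) t) (fun j t => by
        have h1 := hbound j t
        rwa [lintegral_translate_sub_sq_congr hsae] at h1) hc0 hK
    have hle2 := hle.trans (add_le_add hRHS le_rfl)
    set I := ∫⁻ x, ENNReal.ofReal (min (ρ₀ x) K ^ (1 + 2 / (d : ℝ)))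
    -- On the left, `c` is split as `Q` plus the coefficient of the phase space term; that term is
    -- finite and cancels.
    nth_rewrite 1 [← hc] at hle2
    rw [ENNReal.ofReal_add hQ0 (by positivity), ENNReal.ofReal_mul (by positivity),
      ENNReal.ofReal_toReal hMtop, add_mul, mul_assoc] at hle2
    refine (ENNReal.add_le_add_iff_right ?_).1 hle2
    exact ENNReal.mul_ne_top ENNReal.ofReal_ne_top (ENNReal.mul_ne_top hMtop hI)
  have hint : thomasFermiIntegral ρ = ∫⁻ x, ENNReal.ofReal (ρ₀ x ^ (1 + 2 / (d : ℝ))) :=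
    lintegral_congr_ae (hae.mono fun x hx => by simp only [hx])
  rw [hQe, hint, ← lintegral_const_mul' _ _ ENNReal.ofReal_ne_top]
  set s : ℕ → Space d → ℝ≥0∞ := fun k x =>
    ENNReal.ofReal Q * ENNReal.ofReal (min (ρ₀ x) ((k : ℝ) + 1) ^ (1 + 2 / (d : ℝ))) with hs
  have hsm : ∀ k, Measurable (s k) := fun k =>
    (((hρ₀m.min measurable_const).pow_const _).ennreal_ofReal).const_mul _
  have hlim : ∀ x, ENNReal.ofReal Q * ENNReal.ofReal (ρ₀ x ^ (1 + 2 / (d : ℝ))) =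
      liminf (fun k => s k x) atTop := by
    intro x
    refine (Tendsto.liminf_eq (tendsto_const_nhds.congr' ?_)).symm
    obtain ⟨k₀, hk₀⟩ := exists_nat_ge (ρ₀ x)
    filter_upwards [eventually_ge_atTop k₀] with k hk
    have : ρ₀ x ≤ (k : ℝ) + 1 := by
      have : (k₀ : ℝ) ≤ k := by exact_mod_cast hk
      linarith
    simp only [hs, min_eq_left this]
  rw [lintegral_congr hlim]
  -- Removal of the truncation by Fatou's lemma: at each point `min ρ₀ (k + 1)` is eventually `ρ₀`.
  refine (lintegral_liminf_le hsm).trans ?_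
  refine (liminf_le_liminf (Eventually.of_forall fun k => ?_)).trans_eq (liminf_const X)
  simp only [hs]
  rw [lintegral_const_mul' _ _ ENNReal.ofReal_ne_top]
  exact hcut _ (by positivity)

/-- Settles the case `0 * ∞` in the error term: without gradient, `√ρ` is invariant under
translations along a coordinate direction and lies in `L²`, so it vanishes. -/
lemma thomasFermiIntegral_eq_zero_of_gradientEnergy_eq_zero (hd : 1 ≤ d) (hγ_nonneg : 0 ≤ γ)
    (hγ_trace : opTrace γ ≠ ⊤) (hρ : IsDensity γ ρ)
    (h0 : gradientEnergy (fun x => √(ρ x)) = 0) : thomasFermiIntegral ρ = 0 := by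
  obtain ⟨u, v, ρ₀, hu, huv, hvm, hρ₀m, hρ₀0, hvρ, hρint, hae⟩ :=
    exists_density_representative hγ_nonneg hγ_trace hρ
  have heq : ∀ᵐ x, ENNReal.ofReal (ρ₀ x) = ‖√(ρ x)‖ₑ ^ 2 := by
    filter_upwards [hae] with x hx
    rw [hx, enorm_sq_eq_ofReal, Real.norm_eq_abs, sq_abs, Real.sq_sqrt (hρ₀0 x)]
  have hsL2 : MemLp (fun x => √(ρ x)) 2 :=
    memLp_two_of_lintegral
      (Real.continuous_sqrt.comp_aestronglyMeasurable hρ.aestronglyMeasurable)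
      (by rw [← lintegral_congr_ae heq]; exact hρint)
  have hinv : ∀ t : ℝ, ∫⁻ x, ‖√(ρ (x + t • EuclideanSpace.single (⟨0, hd⟩ : Fin d) (1 : ℝ))) -
      √(ρ x)‖ₑ ^ 2 = 0 := by
    intro t
    rcases eq_or_ne t 0 with rfl | ht
    · simp
    have ht2 : ENNReal.ofReal (t ^ 2) ≠ 0 := (ENNReal.ofReal_pos.2 (by positivity)).ne'
    refine le_antisymm ?_ zero_le
    rw [← mul_zero (ENNReal.ofReal (t ^ 2)), ← h0]
    refine le_mul_iInf₂ ht2 ENNReal.ofReal_ne_top fun G hG => ?_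
    rcases eq_or_ne (∫⁻ x in univ, ENNReal.ofReal (‖G x‖ ^ 2 * 1)) ⊤ with htop | htop
    · rw [htop, ENNReal.mul_top ht2]
      exact le_top
    obtain ⟨e, he, hbound⟩ := hG.exists_translate_bound hsL2 rfl htop
    refine (hbound ⟨0, hd⟩ t).trans ?_
    gcongr
    rw [← he]
    exact Finset.single_le_sum (fun _ _ => zero_le) (Finset.mem_univ _)
  have hzero := lintegral_sq_eq_zero_of_translate_invariant hsL2
    (v := EuclideanSpace.single (⟨0, hd⟩ : Fin d) (1 : ℝ)) (by simp) hinv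
  rw [← lintegral_congr_ae heq, lintegral_eq_zero_iff hρ₀m.ennreal_ofReal] at hzero
  refine (lintegral_eq_zero_iff' ?_).2 ?_
  · exact (hρ.aestronglyMeasurable.aemeasurable.pow_const _).ennreal_ofReal
  · filter_upwards [hzero, hae] with x hx1 hx2
    have : ρ₀ x = 0 := le_antisymm (ENNReal.ofReal_eq_zero.1 hx1) (hρ₀0 x)
    rw [hx2, this, Real.zero_rpow (by positivity)]
    simp

theorem kinetic_bound (hd : 1 ≤ d) (hγ_nonneg : 0 ≤ γ) (hγ_le : γ ≤ 1)
    (hγ_trace : opTrace γ ≠ ⊤) (hρ : IsDensity γ ρ) {η : ℝ → ℝ} (hη : IsNormalized η) :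
    ENNReal.ofReal (thomasFermi d) / moment d η ^ (2 / (d : ℝ)) * thomasFermiIntegral ρ ≤
      kineticEnergy γ +
        ENNReal.ofReal (4 / (d : ℝ) ^ 2) * gradientEnergy (fun x => √(ρ x)) * radialEnergy η := by
  have hd0 : (0 : ℝ) < d := by exact_mod_cast hd
  have hk : ENNReal.ofReal (4 / (d : ℝ) ^ 2) ≠ 0 := (ENNReal.ofReal_pos.2 (by positivity)).ne'
  rcases eq_or_ne (gradientEnergy fun x => √(ρ x)) 0 with h0 | h0
  · rw [thomasFermiIntegral_eq_zero_of_gradientEnergy_eq_zero hd hγ_nonneg hγ_trace hρ h0,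
      mul_zero]
    exact zero_le
  rcases eq_or_ne (radialEnergy η) ⊤ with hR | hR
  · rw [hR, ENNReal.mul_top (mul_ne_zero hk h0), add_top]
    exact le_top
  rw [mul_right_comm]
  have ha0 : ENNReal.ofReal (4 / (d : ℝ) ^ 2) * radialEnergy η ≠ 0 :=
    mul_ne_zero hk hη.radialEnergy_ne_zero
  rw [← tsub_le_iff_left]
  refine le_mul_iInf₂ ha0 (ENNReal.mul_ne_top ENNReal.ofReal_ne_top hR) fun G hG => ?_
  rw [tsub_le_iff_left]
  rcases eq_or_ne (∫⁻ x in univ, ENNReal.ofReal (‖G x‖ ^ 2 * 1)) ⊤ with htop | htop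
  · rw [htop, ENNReal.mul_top ha0, add_top]
    exact le_top
  · exact kinetic_bound_of_weakGradient hd hγ_nonneg hγ_le hγ_trace hρ hη hG rfl htop

end MainBound

/-! ### Weak gradients on the line: existence and uniqueness. -/

section OneDimensionalWeakGradient

lemma integrable_testFunction_mul {Ω : Set ℝ} {u φ : ℝ → ℝ} (hu : LocallyIntegrableOn u Ω)
    (hφ : Continuous φ) (hφc : HasCompactSupport φ) (hΩ : tsupport φ ⊆ Ω) :
    Integrable fun x => φ x * u x := by
  have h : IntegrableOn (fun x => φ x * u x) (tsupport φ) :=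
    IntegrableOn.continuousOn_mul hφ.continuousOn (hu.integrableOn_compact_subset hΩ hφc) hφc
  exact (integrableOn_iff_integrable_of_support_subset fun x hx =>
    subset_tsupport φ (left_ne_zero_of_mul hx)).1 h

/-- Integration by parts: `φ η` vanishes near every `t ≤ 0`, so it is differentiable on all of `ℝ`,
and its derivative has integral zero whatever `η` does there. -/
lemma hasWeakGradientOn_of_hasDerivAt {η G : ℝ → ℝ} (hη : ∀ t, 0 < t → HasDerivAt η (G t) t)
    (hG : ContinuousOn G (Ioi 0)) : HasWeakGradientOn (Ioi (0 : ℝ)) η G := by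
  have hηc : ContinuousOn η (Ioi 0) := fun t ht => (hη t ht).continuousAt.continuousWithinAt
  refine ⟨hηc.locallyIntegrableOn measurableSet_Ioi, hG.locallyIntegrableOn measurableSet_Ioi,
    fun φ hφ hφc hsupp v => ?_⟩
  have hφd : ∀ t, HasDerivAt φ (deriv φ t) t := fun t =>
    (hφ.differentiable (by simp) t).hasDerivAt
  have hφ0 : ∀ t, t ∉ Ioi (0 : ℝ) → φ t = 0 := fun t ht =>
    image_eq_zero_of_notMem_tsupport fun h => ht (hsupp h)
  have hdsupp : tsupport (deriv φ) ⊆ tsupport φ := tsupport_deriv_subset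
  have hdφ0 : ∀ t, t ∉ Ioi (0 : ℝ) → deriv φ t = 0 := fun t ht =>
    image_eq_zero_of_notMem_tsupport fun h => ht (hsupp (hdsupp h))
  have i1 : Integrable fun t => φ t * η t := integrable_testFunction_mul
    (hηc.locallyIntegrableOn measurableSet_Ioi) hφ.continuous hφc hsupp
  have i2 : Integrable fun t => φ t * G t := integrable_testFunction_mul
    (hG.locallyIntegrableOn measurableSet_Ioi) hφ.continuous hφc hsupp
  have i3 : Integrable fun t => deriv φ t * η t := integrable_testFunction_mul
    (hηc.locallyIntegrableOn measurableSet_Ioi) (hφ.continuous_deriv (by simp)) hφc.deriv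
    (hdsupp.trans hsupp)
  have hd : ∀ t, HasDerivAt (fun t => φ t * η t) (deriv φ t * η t + φ t * G t) t := by
    intro t
    by_cases ht : 0 < t
    · exact (hφd t).mul (hη t ht)
    · have hnot : t ∉ tsupport φ := fun h => ht (hsupp h)
      have hev : (fun t => φ t * η t) =ᶠ[𝓝 t] fun _ => 0 := by
        filter_upwards [(isClosed_tsupport φ).isOpen_compl.mem_nhds hnot] with s hs
        rw [image_eq_zero_of_notMem_tsupport hs, zero_mul]
      rw [hφ0 t ht, hdφ0 t ht, zero_mul, zero_mul, add_zero]
      exact (hasDerivAt_const t (0 : ℝ)).congr_of_eventuallyEq hev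
  have hzero := integral_eq_zero_of_hasDerivAt_of_integrable hd (i3.add i2) i1
  rw [integral_add i3 i2] at hzero
  have e1 : ∀ t, fderiv ℝ φ t v * η t = v * (deriv φ t * η t) := by
    intro t
    rw [show fderiv ℝ φ t v = v * deriv φ t by
      rw [← fderiv_apply_one_eq_deriv, ← smul_eq_mul, ← map_smul, smul_eq_mul, mul_one], mul_assoc]
  rw [setIntegral_eq_integral_of_forall_compl_eq_zero fun t ht => by
      rw [mul_comm, e1, hdφ0 t ht, zero_mul, mul_zero],
    setIntegral_eq_integral_of_forall_compl_eq_zero fun t ht => by rw [hφ0 t ht, zero_mul]]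
  have e2 : ∀ t, φ t * inner ℝ (G t) v = v * (φ t * G t) := by
    intro t
    rw [show inner ℝ (G t) v = v * G t by simp]
    ring
  simp_rw [mul_comm (η _), e1, e2]
  rw [integral_const_mul, integral_const_mul, eq_neg_of_add_eq_zero_left hzero, mul_neg]

lemma HasWeakGradientOn.ae_eq {Ω : Set ℝ} (hΩ : IsOpen Ω) {u G G' : ℝ → ℝ}
    (hG : HasWeakGradientOn Ω u G) (hG' : HasWeakGradientOn Ω u G') :
    G =ᵐ[volume.restrict Ω] G' := by
  have h : ∀ᵐ x, x ∈ Ω → (G - G') x = 0 := by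
    refine hΩ.ae_eq_zero_of_integral_contDiff_smul_eq_zero
      (hG.locallyIntegrableOn_grad.sub hG'.locallyIntegrableOn_grad) fun φ hφ hφc hsupp => ?_
    have i1 := integrable_testFunction_mul hG.locallyIntegrableOn_grad hφ.continuous hφc hsupp
    have i2 := integrable_testFunction_mul hG'.locallyIntegrableOn_grad hφ.continuous hφc hsupp
    have hφ0 : ∀ t, t ∉ Ω → φ t = 0 := fun t ht =>
      image_eq_zero_of_notMem_tsupport fun h => ht (hsupp h)
    have h1 := hG.integral_eq φ hφ hφc hsupp 1
    rw [hG'.integral_eq φ hφ hφc hsupp 1, neg_inj,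
      setIntegral_eq_integral_of_forall_compl_eq_zero fun t ht => by rw [hφ0 t ht, zero_mul],
      setIntegral_eq_integral_of_forall_compl_eq_zero fun t ht => by rw [hφ0 t ht, zero_mul]] at h1
    simp only [show ∀ y : ℝ, inner ℝ y (1 : ℝ) = y by simp] at h1
    simp only [Pi.sub_apply, smul_eq_mul, mul_sub]
    rw [integral_sub i1 i2, h1, sub_self]
  filter_upwards [(ae_restrict_iff' hΩ.measurableSet).2 h] with x hx
  exact sub_eq_zero.1 hx

lemma dirichletIntegral_eq {Ω : Set ℝ} (hΩ : IsOpen Ω) {w u G : ℝ → ℝ}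
    (hG : HasWeakGradientOn Ω u G) :
    dirichletIntegral Ω w u = ∫⁻ x in Ω, ENNReal.ofReal (‖G x‖ ^ 2 * w x) := by
  refine le_antisymm (iInf₂_le G hG) (le_iInf₂ fun G' hG' => le_of_eq ?_)
  exact lintegral_congr_ae ((hG.ae_eq hΩ hG').mono fun x hx => by simp only [hx])

end OneDimensionalWeakGradient

/-! ### The Gaussian profile. -/

section Gaussian

open ProbabilityTheory

variable {ε : ℝ}

/-- In the variable `r = ln t` the squared profile is the normal density of mean `-ε/2` and variance
`ε/2`, so every integral of the profile is a Gaussian expectation. -/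
lemma gaussianProfile_exp_sq (hε : 0 < ε) (r : ℝ) :
    gaussianProfile ε (Real.exp r) ^ 2 = gaussianPDFReal (-(ε / 2)) (ε / 2).toNNReal r := by
  have hpi := Real.pi_pos
  rw [gaussianProfile, gaussianPDFReal_def, Real.log_exp, mul_pow, ← Real.rpow_natCast,
    ← Real.rpow_mul (by positivity), ← Real.exp_nat_mul, Real.coe_toNNReal _ (by positivity)]
  congr 1
  · rw [show 2 * Real.pi * (ε / 2) = Real.pi * ε by ring, Real.sqrt_eq_rpow, ← Real.rpow_neg
      (by positivity)]
    norm_num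
  · congr 1
    push_cast
    field_simp
    ring

lemma lintegral_gaussianProfile_sq_mul (hε : 0 < ε) {p : ℝ → ℝ} (hp : Measurable p)
    (hp0 : ∀ r, 0 ≤ p r) (hint : Integrable p (gaussianReal (-(ε / 2)) (ε / 2).toNNReal)) :
    ∫⁻ r, ENNReal.ofReal (gaussianProfile ε (Real.exp r) ^ 2 * p r) =
      ENNReal.ofReal (∫ r, p r ∂gaussianReal (-(ε / 2)) (ε / 2).toNNReal) := by
  have hv : (ε / 2).toNNReal ≠ 0 := (Real.toNNReal_pos.2 (by positivity)).ne'
  rw [ofReal_integral_eq_lintegral_ofReal hint (Eventually.of_forall hp0),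
    gaussianReal_of_var_ne_zero _ hv,
    lintegral_withDensity_eq_lintegral_mul _ (measurable_gaussianPDF _ _) hp.ennreal_ofReal]
  refine lintegral_congr fun r => ?_
  rw [gaussianProfile_exp_sq hε, ENNReal.ofReal_mul' (hp0 r)]
  rfl

/-- The moment generating function, with exponent `-εp/2 + εp²/4`. It vanishes at `p = 0` and `p =
2`, which are the two normalizations; `p = d + 2` gives the moment. -/
lemma lintegral_gaussianProfile_sq_mul_exp (hε : 0 < ε) (p : ℝ) :
    ∫⁻ r, ENNReal.ofReal (gaussianProfile ε (Real.exp r) ^ 2 * Real.exp (p * r)) =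
      ENNReal.ofReal (Real.exp (ε * p * (p - 2) / 4)) := by
  rw [lintegral_gaussianProfile_sq_mul hε (by fun_prop) (fun r => Real.exp_nonneg _)
    (integrable_exp_mul_gaussianReal p)]
  have h := mgf_gaussianReal (p := gaussianReal (-(ε / 2)) (ε / 2).toNNReal) (X := id)
    Measure.map_id p
  simp only [mgf, id] at h
  rw [h, Real.coe_toNNReal _ (by positivity)]
  ring_nf

lemma lintegral_Ioi_gaussianProfile (hε : 0 < ε) (q : ℝ → ℝ) (p : ℝ)
    (hq : ∀ r, Real.exp r * q (Real.exp r) = Real.exp (p * r)) :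
    ∫⁻ t in Ioi (0 : ℝ), ENNReal.ofReal (gaussianProfile ε t ^ 2 * q t) =
      ENNReal.ofReal (Real.exp (ε * p * (p - 2) / 4)) := by
  rw [lintegral_Ioi_eq_lintegral_exp, ← lintegral_gaussianProfile_sq_mul_exp hε]
  refine lintegral_congr fun r => ?_
  rw [← ENNReal.ofReal_mul (Real.exp_nonneg _), ← hq]
  ring_nf

lemma isNormalized_gaussianProfile (hε : 0 < ε) : IsNormalized (gaussianProfile ε) := by
  have hm : Measurable (gaussianProfile ε) := by
    unfold gaussianProfile
    have := Real.measurable_log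
    fun_prop
  refine ⟨hm.aestronglyMeasurable, ?_, ?_⟩
  · simp only [div_eq_mul_inv]
    rw [lintegral_Ioi_gaussianProfile hε (fun t => t⁻¹) 0 fun r => by
      rw [mul_inv_cancel₀ (Real.exp_pos r).ne', zero_mul, Real.exp_zero]]
    simp
  · rw [lintegral_Ioi_gaussianProfile hε (fun t => t) 2 fun r => by
      rw [← Real.exp_add, two_mul]]
    simp

lemma moment_gaussianProfile (hε : 0 < ε) (d : ℕ) :
    moment d (gaussianProfile ε) = ENNReal.ofReal (Real.exp (ε * d * (2 + d) / 4)) := by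
  rw [moment, lintegral_Ioi_gaussianProfile hε (fun t => t ^ (d + 1)) (d + 2) fun r => by
    rw [← pow_succ', ← Real.exp_nat_mul]; push_cast; ring_nf]
  ring_nf

lemma hasDerivAt_gaussianProfile (ε : ℝ) {t : ℝ} (ht : 0 < t) :
    HasDerivAt (gaussianProfile ε)
      (-(ε / 2 + Real.log t) / (ε * t) * gaussianProfile ε t) t := by
  have h1 : HasDerivAt (fun t => -(ε / 2 + Real.log t) ^ 2 / (2 * ε))
      (-(ε / 2 + Real.log t) / (ε * t)) t := by
    have h := (((Real.hasDerivAt_log ht.ne').const_add (ε / 2)).pow 2).neg.div_const (2 * ε)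
    refine h.congr_deriv ?_
    rcases eq_or_ne ε 0 with rfl | hε
    · simp
    · field_simp
      simp
      ring
  refine (h1.exp.const_mul ((Real.pi * ε) ^ (-(1 / 4) : ℝ))).congr_deriv ?_
  rw [gaussianProfile]
  ring

lemma radialEnergy_gaussianProfile (hε : 0 < ε) :
    radialEnergy (gaussianProfile ε) = ENNReal.ofReal (1 / (2 * ε)) := by
  have hcont : ContinuousOn (gaussianProfile ε) (Ioi 0) := fun t ht =>
    (hasDerivAt_gaussianProfile ε ht).continuousAt.continuousWithinAt
  have hG : ContinuousOn (fun t => -(ε / 2 + Real.log t) / (ε * t) * gaussianProfile ε t)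
      (Ioi 0) := by
    refine ContinuousOn.mul (ContinuousOn.div ?_ (by fun_prop) fun t ht => ?_) hcont
    · exact (continuousOn_const.add (Real.continuousOn_log.mono fun t ht => ne_of_gt ht)).neg
    · exact mul_ne_zero hε.ne' (ne_of_gt ht)
  rw [radialEnergy, dirichletIntegral_eq isOpen_Ioi
    (hasWeakGradientOn_of_hasDerivAt (fun t ht => hasDerivAt_gaussianProfile ε ht) hG),
    lintegral_Ioi_eq_lintegral_exp]
  have h1 : ∀ r, ENNReal.ofReal (Real.exp r) * ENNReal.ofReal
      (‖-(ε / 2 + Real.log (Real.exp r)) / (ε * Real.exp r) *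
        gaussianProfile ε (Real.exp r)‖ ^ 2 * Real.exp r) =
      ENNReal.ofReal (gaussianProfile ε (Real.exp r) ^ 2 * ((r - -(ε / 2)) ^ 2 / ε ^ 2)) := by
    intro r
    rw [← ENNReal.ofReal_mul (Real.exp_nonneg _), Real.norm_eq_abs, sq_abs, Real.log_exp]
    congr 1
    have := (Real.exp_pos r).ne'
    field_simp
    ring
  simp_rw [h1]
  -- The logarithmic derivative of the profile in `r` is `-(r + ε/2) / ε`, so the energy is the
  -- variance `ε/2` divided by `ε²`.
  have hvar := variance_eq_integral (μ := gaussianReal (-(ε / 2)) (ε / 2).toNNReal)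
    (X := fun x => x) aemeasurable_id'
  rw [variance_fun_id_gaussianReal, integral_id_gaussianReal,
    Real.coe_toNNReal _ (by positivity)] at hvar
  have hmem : MemLp (fun x => x - -(ε / 2)) 2 (gaussianReal (-(ε / 2)) (ε / 2).toNNReal) :=
    (memLp_id_gaussianReal 2).sub (memLp_const _)
  rw [lintegral_gaussianProfile_sq_mul hε (by fun_prop) (fun r => by positivity)
    (hmem.integrable_sq.div_const _), integral_div, ← hvar]
  congr 1
  field_simp

end Gaussian

end LiebThirring

end

theorem theorem1 (d : ℕ) (hd : 1 ≤ d) (γ : L2 d →L[ℂ] L2 d) (hγ_nonneg : 0 ≤ γ) (hγ_le : γ ≤ 1)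
    (hγ_trace : opTrace γ ≠ ⊤) (ρ : Space d → ℝ) (hρ : IsDensity γ ρ) :
    (∀ η : ℝ → ℝ, IsNormalized η →
      ENNReal.ofReal (thomasFermi d) / moment d η ^ (2 / (d : ℝ)) * thomasFermiIntegral ρ ≤
        kineticEnergy γ +
          ENNReal.ofReal (4 / (d : ℝ) ^ 2) * gradientEnergy (fun x => √(ρ x)) * radialEnergy η) ∧
    (∀ ε : ℝ, 0 < ε →
      IsNormalized (gaussianProfile ε) ∧
      moment d (gaussianProfile ε) = ENNReal.ofReal (Real.exp (ε * d * (2 + d) / 4)) ∧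
      radialEnergy (gaussianProfile ε) = ENNReal.ofReal (1 / (2 * ε)) ∧
      ENNReal.ofReal (thomasFermi d * Real.exp (-ε * (1 + (d : ℝ) / 2))) *
          thomasFermiIntegral ρ ≤
        kineticEnergy γ +
          ENNReal.ofReal (2 / ((d : ℝ) ^ 2 * ε)) * gradientEnergy (fun x => √(ρ x))) := by
  refine ⟨fun η hη => kinetic_bound hd hγ_nonneg hγ_le hγ_trace hρ hη, fun ε hε =>
    ⟨isNormalized_gaussianProfile hε, moment_gaussianProfile hε d,
      radialEnergy_gaussianProfile hε, ?_⟩⟩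
  have hd0 : (0 : ℝ) < d := by exact_mod_cast hd
  have h := kinetic_bound hd hγ_nonneg hγ_le hγ_trace hρ (isNormalized_gaussianProfile hε)
  rw [moment_gaussianProfile hε, radialEnergy_gaussianProfile hε,
    ENNReal.ofReal_rpow_of_pos (Real.exp_pos _), ← ENNReal.ofReal_div_of_pos (by positivity),
    mul_right_comm (ENNReal.ofReal (4 / (d : ℝ) ^ 2)), ← ENNReal.ofReal_mul (by positivity)] at h
  have e1 : thomasFermi d / Real.exp (ε * d * (2 + d) / 4) ^ (2 / (d : ℝ)) =
      thomasFermi d * Real.exp (-ε * (1 + (d : ℝ) / 2)) := by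
    rw [← Real.exp_mul, div_eq_mul_inv, ← Real.exp_neg]
    congr 2
    field_simp
    ring
  have e2 : 4 / (d : ℝ) ^ 2 * (1 / (2 * ε)) = 2 / ((d : ℝ) ^ 2 * ε) := by
    field_simp
    norm_num
  rwa [e1, e2] at h
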